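/- **Setting.** Consider a dissipative quantum neural network with $n\ge 1$ input qubits, $n$ output qubits and no hidden layer. For $j=1,\dots,n$ let the global perceptron $V_j$ be a unitary acting on all $n$ input qubits and on the $j$-th output qubit (and as the identity on the other output qubits), given by a parametrized circuit $$V_j(\vec\theta_j)=\prod_{k=1}^{\eta_j}R_{j,k}(\theta_j^k)W_{j,k},\qquad R_{j,k}(\theta)=e^{-\frac{i}{2}\theta\,\Gamma_{j,k}},$$ where the factors are multiplied from left to right, the $W_{j,k}$ are fixed unitaries and the $\Gamma_{j,k}$ are Hermitian operators on $n+1$ qubits with $\mathrm{Tr}[\Gamma_{j,k}^2]\le 2^{n+1}$. For training data with pure input states $|\phi^{\rm in}_x\rangle$, $x=1,\dots,N$ ($N\ge1$), put $$\rho_x^{\rm out}=\mathrm{Tr}_{\rm in}\big[V_n\cdots V_1\,(|\phi_x^{\rm in}\rangle\langle\phi_x^{\rm in}|\otimes|0\cdots0\rangle\langle0\cdots0|_{\rm out})\,V_1^\dagger\cdots V_n^\dagger\big],\qquad C=\frac1N\sum_{x=1}^N\mathrm{Tr}[O_x\rho_x^{\rm out}].$$ The global cost $C^G$ is the one with $O_x=\mathbb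 1-|\phi_x^{\rm out}\rangle\langle\phi_x^{\rm out}|$ for arbitrary pure $n$-qubit states $|\phi_x^{\rm out}\rangle$. The local cost $C^L$ is the one with $O_x=\mathbb 1-\frac1n\sum_{k=1}^n|\psi_{x,k}\rangle\langle\psi_{x,k}|\otimes\mathbb 1_{\overline k}$, where $|\psi_{x,1}\rangle\otimes\dots\otimes|\psi_{x,n}\rangle$ is a product target state and $\mathbb 1_{\overline k}$ is the identity on all output qubits but the $k$-th. Fix $j$ and an angle $\theta^\nu=\theta_j^\nu$ of $V_j$, and split $V_j=B_jA_j$ with $B_j=\prod_{k=1}^{\nu-1}R_{j,k}W_{j,k}$ and $A_j=\prod_{k=\nu}^{\eta_j}R_{j,k}W_{j,k}$. A random unitary is called a $2$-design if every polynomial of degree at most $2$ in its matrix elements and at most $2$ in those of its adjoint has the same average over it as over the Haar measure of the unitary group. **Theorem.** There are functions $g(n)\in\mathcal O(1/2^{2n})$ and $h(n)\in\mathcal O(1/2^{n})$, depending on $n$ only, such that the following holds for all such networks, training data, $j$ and $\nu$. Let the angles be random in such a way that $A_j$, $B_j$ and all $V_i$ with $i\ne j$ are independent and each of them is a $2$-design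 over $n+1$ qubits. Then the costs are differentiable in $\theta^\nu$, their partial derivatives $\partial_\nu C=\partial C/\partial\theta^\nu$ at the random angles are square integrable, and $$\mathrm{Var}[\partial_\nu C^G]\le g(n),\qquad \mathrm{Var}[\partial_\nu C^L]\le h(n).$$ -/

import Mathlib

open MeasureTheory ProbabilityTheory Matrix

noncomputable section

namespace DQNN

/-! ### The unitary group, Haar measure and unitary designs -/

/-- The Borel sigma-algebra on `U(m)`. -/
instance instMeasurableSpaceUnitary {m : Type*} [Fintype m] [DecidableEq m] :
    MeasurableSpace (unitaryGroup m ℂ) := borel _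

instance instBorelSpaceUnitary {m : Type*} [Fintype m] [DecidableEq m] :
    BorelSpace (unitaryGroup m ℂ) := ⟨rfl⟩

instance instCompactSpaceUnitary {m : Type*} [Fintype m] [DecidableEq m] :
    CompactSpace (unitaryGroup m ℂ) := by
  have hc : IsCompact (Set.pi Set.univ
      (fun _ : m => Set.pi Set.univ (fun _ : m => Metric.closedBall (0 : ℂ) 1))) :=
    isCompact_univ_pi fun _ => isCompact_univ_pi fun _ => isCompact_closedBall 0 1
  have hcl : IsClosed {U : Matrix m m ℂ | star U * U = 1} :=
    isClosed_eq (by fun_prop) continuous_const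
  have heq : ((unitaryGroup m ℂ : Submonoid (Matrix m m ℂ)) : Set (Matrix m m ℂ))
      = {U : Matrix m m ℂ | star U * U = 1} := by
    ext U
    exact mem_unitaryGroup_iff'
  have hcl' : IsClosed ((unitaryGroup m ℂ : Submonoid (Matrix m m ℂ)) : Set (Matrix m m ℂ)) :=
    heq ▸ hcl
  refine isCompact_iff_compactSpace.mp
    (IsCompact.of_isClosed_subset (X := Matrix m m ℂ) hc hcl' ?_)
  intro U hU i _ j _
  simpa using entry_norm_bound_of_unitary hU i j

/-- The Haar probability measure on `U(m)`. -/
def haarUnitary (m : Type*) [Fintype m] [DecidableEq m] : Measure (unitaryGroup m ℂ) :=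
  Measure.haarMeasure ⊤

/-- The value at `U` of a polynomial whose variables stand for the matrix elements of `U`
(`Sum.inl`) and of its adjoint (`Sum.inr`). -/
def polyVal {m : Type*} [Fintype m] [DecidableEq m]
    (p : MvPolynomial ((m × m) ⊕ (m × m)) ℂ) (U : unitaryGroup m ℂ) : ℂ :=
  MvPolynomial.eval
    (Sum.elim (fun e => (U : Matrix m m ℂ) e.1 e.2) (fun e => (U : Matrix m m ℂ)ᴴ e.1 e.2)) p

/-- The random unitary `X` is a unitary `t`-design: polynomials of degree at most `t` in the matrix
elements and at most `t` in those of the adjoint have the same average over `X` as over the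
Haar measure. -/
def IsUnitaryDesign {m : Type*} [Fintype m] [DecidableEq m] {Ω : Type*} [MeasurableSpace Ω]
    (t : ℕ) (X : Ω → unitaryGroup m ℂ) (P : Measure Ω) : Prop :=
  ∀ p : MvPolynomial ((m × m) ⊕ (m × m)) ℂ,
    (∀ s ∈ p.support, ∑ e, s (Sum.inl e) ≤ t ∧ ∑ e, s (Sum.inr e) ≤ t) →
    ∫ ω, polyVal p (X ω) ∂P = ∫ U, polyVal p U ∂(haarUnitary m)

/-! ### Qubit registers -/

/-- Labels of the computational basis of `n` qubits. -/
abbrev Qubits (n : ℕ) : Type := Fin n → Fin 2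

/-- Labels of the computational basis of the `n + 1` qubits on which a global perceptron acts:
all input qubits and one output qubit. -/
abbrev PQubits (n : ℕ) : Type := Qubits n × Fin 2

/-- The operator `|φ⟩⟨φ|`. -/
def ketbra {ι : Type*} (φ : EuclideanSpace ℂ ι) : Matrix ι ι ℂ :=
  Matrix.of fun a b => φ a * star (φ b)

/-- An operator on all input qubits and the `j`-th output qubit, extended by the identity on the
other output qubits. The register is ordered as (input, output). -/
def onInOut {n : ℕ} (j : Fin n) (M : Matrix (PQubits n) (PQubits n) ℂ) :
    Matrix (Qubits n × Qubits n) (Qubits n × Qubits n) ℂ :=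
  Matrix.of fun a b =>
    if ∀ k, k ≠ j → a.2 k = b.2 k then M (a.1, a.2 j) (b.1, b.2 j) else 0

/-- A one-qubit operator on the `j`-th of `n` qubits, extended by the identity on the others. -/
def onQubit {n : ℕ} (j : Fin n) (M : Matrix (Fin 2) (Fin 2) ℂ) :
    Matrix (Qubits n) (Qubits n) ℂ :=
  Matrix.of fun a b => if ∀ k, k ≠ j → a k = b k then M (a j) (b j) else 0

/-- The partial trace over the input register. -/
def traceIn {n : ℕ} (M : Matrix (Qubits n × Qubits n) (Qubits n × Qubits n) ℂ) :
    Matrix (Qubits n) (Qubits n) ℂ :=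
  Matrix.of fun b b' => ∑ a, M (a, b) (a, b')

/-- The state `|0…0⟩` of `n` qubits. -/
def zeroKet (n : ℕ) : EuclideanSpace ℂ (Qubits n) := EuclideanSpace.single 0 1

/-! ### The network without hidden layers -/

/-- `V_n ⋯ V_1` on the register (input, output); the perceptron with the smallest index acts
first. -/
def network {n : ℕ} (V : Fin n → unitaryGroup (PQubits n) ℂ) :
    Matrix (Qubits n × Qubits n) (Qubits n × Qubits n) ℂ :=
  (List.ofFn fun j => onInOut j (V j : Matrix (PQubits n) (PQubits n) ℂ)).reverse.prod

/-- The output state `Tr_in [V (ρ_in ⊗ |0⟩⟨0|) V†]`. -/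
def outState {n : ℕ} (V : Fin n → unitaryGroup (PQubits n) ℂ)
    (ρ : Matrix (Qubits n) (Qubits n) ℂ) : Matrix (Qubits n) (Qubits n) ℂ :=
  traceIn (network V * kroneckerMap (· * ·) ρ (ketbra (zeroKet n)) * (network V)ᴴ)

/-- The cost `(1/N) ∑ₓ Tr [Oₓ ρₓ_out]` (real, because all operators involved are Hermitian). -/
def cost {n N : ℕ} (φin : Fin N → EuclideanSpace ℂ (Qubits n))
    (O : Fin N → Matrix (Qubits n) (Qubits n) ℂ)
    (V : Fin n → unitaryGroup (PQubits n) ℂ) : ℝ :=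
  (1 / (N : ℝ)) * ∑ x, (Matrix.trace (O x * outState V (ketbra (φin x)))).re

/-- The global observable `1 - |φ⟩⟨φ|`. -/
def globalObs {n : ℕ} (φ : EuclideanSpace ℂ (Qubits n)) : Matrix (Qubits n) (Qubits n) ℂ :=
  1 - ketbra φ

/-- The local observable `1 - (1/n) ∑ₖ |ψₖ⟩⟨ψₖ| ⊗ 1` of the product state `ψ₁ ⊗ ⋯ ⊗ ψₙ`. -/
def localObs {n : ℕ} (ψ : Fin n → EuclideanSpace ℂ (Fin 2)) : Matrix (Qubits n) (Qubits n) ℂ :=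
  1 - (1 / (n : ℂ)) • ∑ k, onQubit k (ketbra (ψ k))

/-! ### Parametrized perceptrons -/

/-- The data of a parametrized circuit on `n + 1` qubits: the number of gates, the generators and
the fixed unitaries. -/
structure Circuit (n : ℕ) where
  /-- the number of parametrized gates -/
  depth : ℕ
  /-- the generator of each parametrized gate -/
  gen : Fin depth → Matrix (PQubits n) (PQubits n) ℂ
  /-- the unparametrized unitary that goes with each parametrized gate -/
  fixed : Fin depth → unitaryGroup (PQubits n) ℂ
  gen_hermitian : ∀ k, (gen k).IsHermitian
  gen_trace_sq : ∀ k, (Matrix.trace (gen k * gen k)).re ≤ 2 ^ (n + 1)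

/-- `R(t) = exp(-(i/2) t Γ)`. -/
def rot {m : Type*} [Fintype m] [DecidableEq m] (Γ : Matrix m m ℂ) (t : ℝ) : Matrix m m ℂ :=
  NormedSpace.exp ((-(Complex.I / 2) * (t : ℂ)) • Γ)

theorem rot_mem {m : Type*} [Fintype m] [DecidableEq m] {Γ : Matrix m m ℂ}
    (hΓ : Γ.IsHermitian) (t : ℝ) : rot Γ t ∈ unitaryGroup m ℂ := by
  rw [mem_unitaryGroup_iff']
  have h : star (rot Γ t) = NormedSpace.exp (-((-(Complex.I / 2) * (t : ℂ)) • Γ)) := by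
    rw [rot, star_eq_conjTranspose, ← Matrix.exp_conjTranspose, conjTranspose_smul, hΓ.eq]
    congr 1
    rw [← neg_smul]
    congr 1
    simp [neg_div]
  rw [h, Matrix.exp_neg, rot]
  exact Matrix.nonsing_inv_mul _ ((Matrix.isUnit_iff_isUnit_det _).1 (Matrix.isUnit_exp _))

/-- The gate `R_k(t) W_k`. -/
def Circuit.gate {n : ℕ} (c : Circuit n) (k : Fin c.depth) (t : ℝ) :
    unitaryGroup (PQubits n) ℂ :=
  ⟨rot (c.gen k) t, rot_mem (c.gen_hermitian k) t⟩ * c.fixed k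

/-- The factors `R_1 W_1, R_2 W_2, …` in the order in which they are multiplied. -/
def Circuit.gates {n : ℕ} (c : Circuit n) (θ : Fin c.depth → ℝ) :
    List (unitaryGroup (PQubits n) ℂ) :=
  List.ofFn fun k => c.gate k (θ k)

/-- The perceptron `V(θ) = R_1 W_1 R_2 W_2 ⋯`. -/
def Circuit.perceptron {n : ℕ} (c : Circuit n) (θ : Fin c.depth → ℝ) :
    unitaryGroup (PQubits n) ℂ :=
  (c.gates θ).prod

/-- The part `B` of the perceptron: the factors before the one with index `ν`. -/
def Circuit.partB {n : ℕ} (c : Circuit n) (ν : Fin c.depth) (θ : Fin c.depth → ℝ) :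
    unitaryGroup (PQubits n) ℂ :=
  ((c.gates θ).take ν).prod

/-- The part `A` of the perceptron: the factors from the one with index `ν` on. -/
def Circuit.partA {n : ℕ} (c : Circuit n) (ν : Fin c.depth) (θ : Fin c.depth → ℝ) :
    unitaryGroup (PQubits n) ℂ :=
  ((c.gates θ).drop ν).prod

/-- All gate angles of a network with perceptron circuits `c`. -/
abbrev Angles {n : ℕ} (c : Fin n → Circuit n) : Type := (j : Fin n) → Fin (c j).depth → ℝ

/-- The cost as a function of the angles. -/
def angleCost {n N : ℕ} (c : Fin n → Circuit n) (φin : Fin N → EuclideanSpace ℂ (Qubits n))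
    (O : Fin N → Matrix (Qubits n) (Qubits n) ℂ) (θ : Angles c) : ℝ :=
  cost φin O fun j => (c j).perceptron (θ j)

/-- The angles `θ` with the `ν`-th angle of the `j`-th perceptron replaced by `t`. -/
def setAngle {n : ℕ} {c : Fin n → Circuit n} (θ : Angles c) (j : Fin n) (ν : Fin (c j).depth)
    (t : ℝ) : Angles c :=
  Function.update θ j (Function.update (θ j) ν t)

/-- The partial derivative of the cost with respect to the `ν`-th angle of the `j`-th
perceptron. -/
def partialCost {n N : ℕ} (c : Fin n → Circuit n) (φin : Fin N → EuclideanSpace ℂ (Qubits n))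
    (O : Fin N → Matrix (Qubits n) (Qubits n) ℂ) (j : Fin n) (ν : Fin (c j).depth)
    (θ : Angles c) : ℝ :=
  deriv (fun t => angleCost c φin O (setAngle θ j ν t)) (θ j ν)

/-- The independent random unitaries of the network: `B_j` (index `none`), `A_j` (index `some j`),
and `V_i` (index `some i`, `i ≠ j`). -/
def blocks {n : ℕ} (c : Fin n → Circuit n) (j : Fin n) (ν : Fin (c j).depth) :
    Option (Fin n) → Angles c → unitaryGroup (PQubits n) ℂ
  | none, θ => (c j).partB ν (θ j)
  | some i, θ => if i = j then (c j).partA ν (θ j) else (c i).perceptron (θ i)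

end DQNN

end

/-!
# Barren plateaus of dissipative quantum neural networks with global perceptrons

Write `K̂ = 1 ⊗ K` for an output observable, `s = |φ⟩ ⊗ |0…0⟩` for the initial state and
`U = V_n ⋯ V_1` for the network. With `V_j = B A`, the derivative of `⟨s|U† K̂ U|s⟩` with respect to
an angle with generator `Γ` is (`gradient`, `hasDerivAt_trace_outState`)
`-(i/2) (tr [K̂ U_Γ |s⟩⟨s| U†] - tr [K̂ U |s⟩⟨s| U_Γ†])`, where `U_Γ` is `U` with `V_j` replaced by
`B Γ A`. As both observables have the form `1 - K` and the output state has trace one, only `K`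
matters, and the variance is at most the second moment, which by convexity is at most the average
over the training data of `E |gradient|²`.

The function `|gradient|²` is a polynomial of bidegree `(2, 2)` in each of the independent blocks
`A`, `B`, `V_i` separately. Hence the designs may be replaced by Haar unitaries, one at a time
(`integral_designs_eq_integral_haar`). Now Haar measure is invariant, so `B` and `V_j = B A` may be
taken as the independent variables instead of `B` and `A`. In these variables the gradient is
`tr [y B Γ B†]`, where `y` depends on the perceptrons only and is, up to the factor `-(i/2)`, the
partial trace of the commutator of the rank one operator `|v⟩⟨v|`, `v` being the state right after
`V_j` has acted, with the observable `K̂` evolved back to that time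
(`exists_gradient_eq_trace`). Such a `y` is traceless, with squared Frobenius norm at most
`‖K̂ U s‖²`.

Two averages then give one factor `2⁻ⁿ` each. On `d = 2 ^ (n + 1)` dimensions, a traceless `y` has
`∫ |tr (y B Γ B†)|² dB ≤ 2 ‖Γ‖² ‖y‖² / (d (d - 1))` with Frobenius norms (`orbitMoment_le`), and
`‖Γ‖² ≤ d`: diagonal phases and permutation matrices settle the case of a `y` with vanishing
diagonal, and conjugation by a unitary all of whose entries have equal modulus reduces the diagonal
part of `y` to that case. Averaging
over the perceptrons makes the output maximally mixed, so that `‖K̂ U s‖²` has mean `2⁻ⁿ ‖K‖²`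
(`integral_frobSq_onOut_network`). Altogether `E |gradient|² ≤ 2 · 4⁻ⁿ ‖K‖²`. The squared norm
`‖K‖²` is `1` for the global observable and at most `2ⁿ` for the local one.
-/

open scoped Kronecker

noncomputable section

namespace DQNN

/-! ### Haar measure on the unitary group: invariance -/

section Haar

variable {m : Type*} [Fintype m] [DecidableEq m]

instance instIsProbabilityMeasureHaar : IsProbabilityMeasure (haarUnitary m) :=
  ⟨Measure.haarMeasure_self⟩

instance instIsMulLeftInvariantHaar : (haarUnitary m).IsMulLeftInvariant :=
  inferInstanceAs (Measure.haarMeasure ⊤).IsMulLeftInvariant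

instance instSecondCountableUnitary : SecondCountableTopology (unitaryGroup m ℂ) :=
  inferInstanceAs (SecondCountableTopology
    {U : m → m → ℂ // U ∈ (unitaryGroup m ℂ : Set (Matrix m m ℂ))})

theorem integrable_of_continuous {X E : Type*} [TopologicalSpace X]
    [CompactSpace X] [MeasurableSpace X] [OpensMeasurableSpace X] [NormedAddCommGroup E]
    [SecondCountableTopology X]
    {μ : Measure X} [IsFiniteMeasure μ] {f : X → E} (hf : Continuous f) : Integrable f μ :=
  hf.integrable_of_hasCompactSupport (HasCompactSupport.of_compactSpace f)

/-- The matrix `U N U†`. -/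
def conjBy (U : unitaryGroup m ℂ) (N : Matrix m m ℂ) : Matrix m m ℂ :=
  (U : Matrix m m ℂ) * N * (U : Matrix m m ℂ)ᴴ

theorem unitary_mul_conjTranspose (U : unitaryGroup m ℂ) :
    (U : Matrix m m ℂ) * (U : Matrix m m ℂ)ᴴ = 1 := mem_unitaryGroup_iff.1 U.2

theorem unitary_conjTranspose_mul (U : unitaryGroup m ℂ) :
    (U : Matrix m m ℂ)ᴴ * (U : Matrix m m ℂ) = 1 := mem_unitaryGroup_iff'.1 U.2

theorem conjBy_mul (U V : unitaryGroup m ℂ) (N : Matrix m m ℂ) :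
    conjBy (U * V) N = conjBy U (conjBy V N) := by
  simp [conjBy, conjTranspose_mul, Matrix.mul_assoc]

theorem trace_conjBy (U : unitaryGroup m ℂ) (N : Matrix m m ℂ) :
    trace (conjBy U N) = trace N := by
  rw [conjBy, trace_mul_comm, ← Matrix.mul_assoc, unitary_conjTranspose_mul, Matrix.one_mul]

@[fun_prop]
theorem continuous_unitary_coe :
    Continuous fun U : unitaryGroup m ℂ => (U : Matrix m m ℂ) := continuous_subtype_val

@[fun_prop]
theorem continuous_conjBy (N : Matrix m m ℂ) :
    Continuous fun U : unitaryGroup m ℂ => conjBy U N := by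
  unfold conjBy; fun_prop

@[fun_prop]
theorem continuous_conjBy_apply (N : Matrix m m ℂ) (a b : m) :
    Continuous fun U : unitaryGroup m ℂ => conjBy U N a b := by
  exact (continuous_conjBy N).matrix_elem a b

theorem integral_conjBy_conjBy {E : Type*} [NormedAddCommGroup E] [NormedSpace ℝ E]
    (f : Matrix m m ℂ → E) (U : unitaryGroup m ℂ) (N : Matrix m m ℂ) :
    ∫ V, f (conjBy U (conjBy V N)) ∂(haarUnitary m) = ∫ V, f (conjBy V N) ∂(haarUnitary m) := by
  simp_rw [← conjBy_mul]
  exact integral_mul_left_eq_self (fun V => f (conjBy V N)) U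

/-- The squared Frobenius norm. -/
def frobSq {ι κ : Type*} [Fintype ι] [Fintype κ] (M : Matrix ι κ ℂ) : ℝ := ∑ a, ∑ b, ‖M a b‖ ^ 2

theorem frobSq_nonneg {ι κ : Type*} [Fintype ι] [Fintype κ] (M : Matrix ι κ ℂ) : 0 ≤ frobSq M := by
  unfold frobSq; positivity

theorem ofReal_frobSq {ι κ : Type*} [Fintype ι] [Fintype κ] (M : Matrix ι κ ℂ) :
    (frobSq M : ℂ) = trace (M * Mᴴ) := by
  simp [frobSq, trace, mul_apply, Complex.mul_conj, Complex.normSq_eq_norm_sq]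

theorem frobSq_conjBy (U : unitaryGroup m ℂ) (N : Matrix m m ℂ) :
    frobSq (conjBy U N) = frobSq N := by
  have h : conjBy U N * (conjBy U N)ᴴ = conjBy U (N * Nᴴ) := by
    simp only [conjBy, conjTranspose_mul, conjTranspose_conjTranspose, Matrix.mul_assoc]
    rw [← Matrix.mul_assoc (U : Matrix m m ℂ)ᴴ, unitary_conjTranspose_mul, Matrix.one_mul]
  have : (frobSq (conjBy U N) : ℂ) = frobSq N := by
    rw [ofReal_frobSq, ofReal_frobSq, h, trace_conjBy]
  exact_mod_cast this

/-- The diagonal unitary with entry `i` at `a` and `1` elsewhere. -/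
def phaseAt (a : m) : unitaryGroup m ℂ :=
  ⟨diagonal fun x => if x = a then Complex.I else 1, by
    rw [mem_unitaryGroup_iff', star_eq_conjTranspose, diagonal_conjTranspose, diagonal_mul_diagonal,
      ← diagonal_one]
    congr 1
    ext x
    by_cases h : x = a <;> simp [h]⟩

theorem conjBy_phaseAt (a : m) (N : Matrix m m ℂ) (x y : m) :
    conjBy (phaseAt a) N x y =
      (if x = a then Complex.I else 1) * N x y * (if y = a then -Complex.I else 1) := by
  simp only [conjBy, phaseAt, diagonal_conjTranspose, mul_diagonal, diagonal_mul, Pi.star_apply]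
  congr 1
  split_ifs <;> simp

/-- The permutation matrix of `σ`, as a unitary. -/
def permUnitary (σ : Equiv.Perm m) : unitaryGroup m ℂ :=
  ⟨σ.permMatrix ℂ, by
    rw [mem_unitaryGroup_iff', star_eq_conjTranspose, conjTranspose_permMatrix, ← permMatrix_mul]
    simp⟩

theorem conjBy_permUnitary (σ : Equiv.Perm m) (N : Matrix m m ℂ) (x y : m) :
    conjBy (permUnitary σ) N x y = N (σ x) (σ y) := by
  simp [conjBy, permUnitary, Equiv.Perm.permMatrix, conjTranspose_permMatrix,
    PEquiv.toMatrix_toPEquiv_mul, PEquiv.mul_toMatrix_toPEquiv]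
  rfl

/-- There is a unitary all of whose entries have the same modulus, namely the Fourier transform of
a group structure on the index set. -/
theorem exists_flat_unitary (m : Type*) [Fintype m] [DecidableEq m] [Nonempty m] :
    ∃ F : unitaryGroup m ℂ, ∀ a b, ‖(F : Matrix m m ℂ) a b‖ ^ 2 = 1 / Fintype.card m := by
  have : NeZero (Fintype.card m) := ⟨Fintype.card_ne_zero⟩
  let _ : AddCommGroup m := (Fintype.equivFin m).addCommGroup
  have hcard : Fintype.card m = Fintype.card (AddChar m ℂ) := AddChar.card_eq.symm
  let e : m ≃ AddChar m ℂ := Fintype.equivOfCardEq hcard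
  have hd : (0 : ℝ) < Fintype.card m := by exact_mod_cast Fintype.card_pos
  have hs : ((Real.sqrt (Fintype.card m) : ℝ) : ℂ) * (Real.sqrt (Fintype.card m) : ℝ)
      = Fintype.card m := by
    rw [← Complex.ofReal_mul, Real.mul_self_sqrt hd.le]; simp
  have hs0 : ((Real.sqrt (Fintype.card m) : ℝ) : ℂ) ≠ 0 := by
    intro h
    rw [h, zero_mul] at hs
    exact hd.ne (by exact_mod_cast hs)
  refine ⟨⟨Matrix.of fun a b => e a b / (Real.sqrt (Fintype.card m) : ℝ), ?_⟩, fun a b => ?_⟩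
  · rw [mem_unitaryGroup_iff]
    ext a b
    have h := AddChar.wInner_cWeight_eq_boole (R := ℂ) (e b) (e a)
    rw [RCLike.wInner_cWeight_eq_expect, Finset.expect_eq_sum_div_card] at h
    simp only [mul_apply, of_apply, star_apply, RCLike.inner_apply] at h ⊢
    have h2 : ∀ x, e a x / ((Real.sqrt (Fintype.card m) : ℝ) : ℂ) *
        star (e b x / ((Real.sqrt (Fintype.card m) : ℝ) : ℂ))
        = (e a x * (starRingEnd ℂ) (e b x)) / Fintype.card m := by
      intro x
      rw [← hs]
      simp only [star_div₀, RCLike.star_def, Complex.conj_ofReal]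
      field_simp
    simp_rw [h2]
    rw [← Finset.sum_div]
    rw [Finset.card_univ] at h
    rw [h]
    simp [one_apply, eq_comm]
  · simp only [of_apply, norm_div, AddChar.norm_apply, Complex.norm_real, Real.norm_eq_abs,
      div_pow, sq_abs, one_pow]
    rw [Real.sq_sqrt hd.le]

end Haar

/-! ### First and second moments of a Haar random unitary -/

section Moments

variable {m : Type*} [Fintype m] [DecidableEq m]

/-- The average of `U N U†` over Haar measure is the multiple of the identity with the same
trace. -/
theorem integral_conjBy_apply (N : Matrix m m ℂ) (a b : m) :
    ∫ U, conjBy U N a b ∂(haarUnitary m) = if a = b then trace N / Fintype.card m else 0 := by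
  split_ifs with hab
  · subst hab
    -- Permutation matrices exchange the diagonal entries, whose sum is the trace.
    have hperm : ∀ x, ∫ U, conjBy U N x x ∂(haarUnitary m)
        = ∫ U, conjBy U N a a ∂(haarUnitary m) := by
      intro x
      rw [← integral_conjBy_conjBy (fun M => M a a) (permUnitary (Equiv.swap a x))]
      simp [conjBy_permUnitary]
    have hsum : ∑ x, ∫ U, conjBy U N x x ∂(haarUnitary m) = trace N := by
      rw [← integral_finsetSum _ fun x _ =>
        integrable_of_continuous (continuous_conjBy_apply N x x)]
      have : ∀ U : unitaryGroup m ℂ, ∑ x, conjBy U N x x = trace N := fun U => trace_conjBy U N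
      simp [this]
    simp only [hperm, Finset.sum_const, Finset.card_univ, nsmul_eq_mul] at hsum
    have hne : Nonempty m := ⟨a⟩
    have : (Fintype.card m : ℂ) ≠ 0 := by exact_mod_cast Fintype.card_ne_zero
    rw [← hsum]
    field_simp
  · -- A phase at `a` multiplies the entry `(a, b)` by `i`.
    have h := integral_conjBy_conjBy (fun M : Matrix m m ℂ => M a b) (phaseAt a) N
    simp only [conjBy_phaseAt, if_true, if_neg (Ne.symm hab), mul_one] at h
    rw [integral_const_mul] at h
    have h2 : (Complex.I - 1) * ∫ U, conjBy U N a b ∂(haarUnitary m) = 0 := by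
      linear_combination h
    refine (mul_eq_zero.1 h2).resolve_left fun h3 => ?_
    have := congrArg Complex.re h3
    simp at this

/-- Diagonal phases annihilate the mixed second moments of off-diagonal entries. -/
theorem integral_conjBy_mul_star_eq_zero (N : Matrix m m ℂ) {a b c d : m} (hab : a ≠ b)
    (h : ¬ (a = c ∧ b = d)) :
    ∫ U, conjBy U N a b * star (conjBy U N c d) ∂(haarUnitary m) = 0 := by
  -- `w` is the factor that the integrand acquires from a phase at `x`.
  have key : ∀ x : m, ∃ w : ℂ, w = ((if a = x then Complex.I else 1) *
      (if b = x then -Complex.I else 1)) * star ((if c = x then Complex.I else 1) *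
      (if d = x then -Complex.I else 1)) ∧
      (w - 1) * ∫ U, conjBy U N a b * star (conjBy U N c d) ∂(haarUnitary m) = 0 := by
    intro x
    refine ⟨_, rfl, ?_⟩
    have h := integral_conjBy_conjBy
      (fun M : Matrix m m ℂ => M a b * star (M c d)) (phaseAt x) N
    simp only [conjBy_phaseAt] at h
    rw [sub_mul, one_mul, sub_eq_zero]
    refine Eq.trans ?_ h
    rw [← integral_const_mul]
    congr 1
    ext U
    simp only [star_mul']
    ring
  have hI : Complex.I - 1 ≠ 0 := fun h3 => by simpa using congrArg Complex.re h3
  have hI' : -Complex.I - 1 ≠ 0 := fun h3 => by simpa using congrArg Complex.re h3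
  have hI2 : (-1 : ℂ) - 1 ≠ 0 := by norm_num
  -- The factor differs from `1` for `x = b` if `c = a`, and for `x = a` otherwise.
  by_cases hca : c = a
  · subst hca
    have hbd : b ≠ d := fun h' => h ⟨rfl, h'⟩
    obtain ⟨w, hw, h0⟩ := key b
    rw [if_neg hab, if_pos rfl, if_neg hbd.symm] at hw
    refine (mul_eq_zero.1 h0).resolve_left ?_
    rw [hw]
    simpa using hI'
  · obtain ⟨w, hw, h0⟩ := key a
    refine (mul_eq_zero.1 h0).resolve_left ?_
    rw [if_pos rfl, if_neg hab.symm, if_neg hca] at hw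
    rw [hw]
    split_ifs
    · simpa using hI2
    · simpa using hI

theorem integral_norm_conjBy_sq_eq (N : Matrix m m ℂ) {a b c d : m} (hab : a ≠ b)
    (hcd : c ≠ d) :
    ∫ U, ‖conjBy U N a b‖ ^ 2 ∂(haarUnitary m) = ∫ U, ‖conjBy U N c d‖ ^ 2 ∂(haarUnitary m) := by
  obtain ⟨σ, h1, h2⟩ := MulAction.is_two_pretransitive_iff.1
    (Equiv.Perm.isMultiplyPretransitive m 2) hcd hab
  rw [← integral_conjBy_conjBy (fun M => ‖M c d‖ ^ 2) (permUnitary σ)]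
  simp only [conjBy_permUnitary]
  rw [Equiv.Perm.smul_def] at h1 h2
  rw [h1, h2]

/-- The `d (d - 1)` off-diagonal entries have equal second moments, which add up to at most the
squared Frobenius norm. -/
theorem integral_norm_conjBy_sq_le (N : Matrix m m ℂ) {a b : m} (hab : a ≠ b) :
    (Fintype.card m * (Fintype.card m - 1) : ℝ) * ∫ U, ‖conjBy U N a b‖ ^ 2 ∂(haarUnitary m)
      ≤ frobSq N := by
  have hint : ∀ x y : m, Integrable (fun U => ‖conjBy U N x y‖ ^ 2) (haarUnitary m) :=
    fun x y => integrable_of_continuous (by fun_prop)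
  calc (Fintype.card m * (Fintype.card m - 1) : ℝ) * ∫ U, ‖conjBy U N a b‖ ^ 2 ∂(haarUnitary m)
      = ∑ e ∈ (Finset.univ : Finset m).offDiag,
          ∫ U, ‖conjBy U N e.1 e.2‖ ^ 2 ∂(haarUnitary m) := by
        rw [Finset.sum_congr rfl fun e he => integral_norm_conjBy_sq_eq N
          (Finset.mem_offDiag.1 he).2.2 hab]
        rw [Finset.sum_const, Finset.offDiag_card, nsmul_eq_mul, Finset.card_univ,
          Nat.cast_sub (Nat.le_mul_self _)]
        push_cast
        ring
    _ ≤ ∑ e : m × m, ∫ U, ‖conjBy U N e.1 e.2‖ ^ 2 ∂(haarUnitary m) :=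
        Finset.sum_le_sum_of_subset_of_nonneg (Finset.subset_univ _)
          fun e _ _ => integral_nonneg fun U => by positivity
    _ = ∫ U, frobSq (conjBy U N) ∂(haarUnitary m) := by
        rw [← integral_finsetSum _ fun e _ => hint e.1 e.2]
        simp only [frobSq, Fintype.sum_prod_type]
    _ = frobSq N := by simp [frobSq_conjBy]

/-- The second moment of the linear functional `tr (y ·)` on the unitary orbit of `N`. -/
def orbitMoment (N y : Matrix m m ℂ) : ℝ :=
  ∫ U, ‖trace (y * conjBy U N)‖ ^ 2 ∂(haarUnitary m)

theorem integrable_orbitMoment (N y : Matrix m m ℂ) :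
    Integrable (fun U => ‖trace (y * conjBy U N)‖ ^ 2) (haarUnitary m) :=
  integrable_of_continuous (by fun_prop)

theorem orbitMoment_conjBy (N y : Matrix m m ℂ) (F : unitaryGroup m ℂ) :
    orbitMoment N (conjBy F y) = orbitMoment N y := by
  unfold orbitMoment
  rw [← integral_conjBy_conjBy (fun M => ‖trace (conjBy F y * M)‖ ^ 2) F]
  congr 1
  ext U
  have : conjBy F y * conjBy F (conjBy U N) = conjBy F (y * conjBy U N) := by
    simp only [conjBy, Matrix.mul_assoc]
    rw [← Matrix.mul_assoc (F : Matrix m m ℂ)ᴴ, unitary_conjTranspose_mul, Matrix.one_mul]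
  rw [this, trace_conjBy]

theorem orbitMoment_add_le (N y z : Matrix m m ℂ) :
    orbitMoment N (y + z) ≤ 2 * orbitMoment N y + 2 * orbitMoment N z := by
  unfold orbitMoment
  rw [← integral_const_mul, ← integral_const_mul,
    ← integral_add ((integrable_orbitMoment N y).const_mul 2)
      ((integrable_orbitMoment N z).const_mul 2)]
  refine integral_mono (integrable_orbitMoment N _)
    (((integrable_orbitMoment N y).const_mul 2).add
      ((integrable_orbitMoment N z).const_mul 2)) fun U => ?_
  simp only [Matrix.add_mul, trace_add]
  have h := norm_add_le (trace (y * conjBy U N)) (trace (z * conjBy U N))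
  nlinarith [norm_nonneg (trace (y * conjBy U N) + trace (z * conjBy U N)),
    sq_nonneg (‖trace (y * conjBy U N)‖ - ‖trace (z * conjBy U N)‖)]

/-- For a matrix with vanishing diagonal only second moments of off-diagonal entries occur, and the
mixed ones among them vanish. -/
theorem orbitMoment_eq_of_diag_eq_zero (N y : Matrix m m ℂ) (hy : ∀ a, y a a = 0) :
    orbitMoment N y
      = ∑ a, ∑ b, ‖y a b‖ ^ 2 * ∫ U, ‖conjBy U N b a‖ ^ 2 ∂(haarUnitary m) := by
  have hc : (orbitMoment N y : ℂ)
      = ∑ e : m × m, ∑ f : m × m, (y e.1 e.2 * star (y f.1 f.2)) *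
        ∫ U, conjBy U N e.2 e.1 * star (conjBy U N f.2 f.1) ∂(haarUnitary m) := by
    unfold orbitMoment
    rw [← integral_complex_ofReal]
    have hint : ∀ e f : m × m, Integrable (fun U => (y e.1 e.2 * star (y f.1 f.2)) *
        (conjBy U N e.2 e.1 * star (conjBy U N f.2 f.1))) (haarUnitary m) :=
      fun e f => integrable_of_continuous (by fun_prop)
    simp_rw [← integral_const_mul]
    rw [Finset.sum_congr rfl fun e _ => (integral_finsetSum _ fun f _ => hint e f).symm,
      ← integral_finsetSum _ fun e _ => integrable_finsetSum _ fun f _ => hint e f]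
    congr 1
    ext U
    have ht : trace (y * conjBy U N) = ∑ e : m × m, y e.1 e.2 * conjBy U N e.2 e.1 := by
      simp [trace, mul_apply, Fintype.sum_prod_type]
    rw [Complex.ofReal_pow, ← Complex.mul_conj', ht, map_sum, Finset.sum_mul_sum]
    refine Finset.sum_congr rfl fun e _ => Finset.sum_congr rfl fun f _ => ?_
    simp only [map_mul, RCLike.star_def]
    ring
  have hd : ∀ e : m × m, ∑ f : m × m, (y e.1 e.2 * star (y f.1 f.2)) *
        ∫ U, conjBy U N e.2 e.1 * star (conjBy U N f.2 f.1) ∂(haarUnitary m)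
      = ((‖y e.1 e.2‖ ^ 2 * ∫ U, ‖conjBy U N e.2 e.1‖ ^ 2 ∂(haarUnitary m) : ℝ) : ℂ) := by
    intro e
    rw [Finset.sum_eq_single e]
    · push_cast
      rw [← integral_complex_ofReal]
      simp [Complex.mul_conj, Complex.normSq_eq_norm_sq]
    · intro f _ hf
      by_cases he : e.1 = e.2
      · rw [he, hy]; simp
      rw [integral_conjBy_mul_star_eq_zero N (Ne.symm he), mul_zero]
      rintro ⟨h1, h2⟩
      exact hf (Prod.ext h2.symm h1.symm)
    · simp
  rw [Finset.sum_congr rfl fun e _ => hd e, ← Complex.ofReal_sum, Fintype.sum_prod_type] at hc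
  exact_mod_cast hc

theorem orbitMoment_le_of_diag_eq_zero (N y : Matrix m m ℂ) (hy : ∀ a, y a a = 0) :
    (Fintype.card m * (Fintype.card m - 1) : ℝ) * orbitMoment N y ≤ frobSq N * frobSq y := by
  rw [orbitMoment_eq_of_diag_eq_zero N y hy]
  rw [show frobSq y = ∑ a, ∑ b, ‖y a b‖ ^ 2 from rfl]
  simp only [Finset.mul_sum]
  refine Finset.sum_le_sum fun a _ => Finset.sum_le_sum fun b _ => ?_
  by_cases hab : b = a
  · subst hab; simp [hy]
  · have := integral_norm_conjBy_sq_le N hab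
    nlinarith [sq_nonneg ‖y a b‖]

/-- Conjugation with a flat unitary turns the diagonal part of a traceless matrix into a matrix
with vanishing diagonal, so that both parts are covered by the case of vanishing diagonal. -/
theorem orbitMoment_le [Nonempty m] (N y : Matrix m m ℂ) (hy : trace y = 0) :
    (Fintype.card m * (Fintype.card m - 1) : ℝ) * orbitMoment N y ≤ 2 * frobSq N * frobSq y := by
  obtain ⟨F, hF⟩ := exists_flat_unitary m
  -- The diagonal entries of `F D F†` are all equal to `tr D / d = 0`.
  set D : Matrix m m ℂ := diagonal fun a => y a a with hD
  have hoff : ∀ a, (y - D) a a = 0 := by simp [hD]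
  have hdiag : ∀ a, conjBy F D a a = 0 := by
    intro a
    have h : conjBy F D a a = ∑ b, y b b * (‖(F : Matrix m m ℂ) a b‖ ^ 2 : ℝ) := by
      rw [conjBy, hD, mul_apply]
      refine Finset.sum_congr rfl fun b _ => ?_
      rw [mul_diagonal, conjTranspose_apply]
      push_cast
      rw [← Complex.mul_conj']
      simp only [RCLike.star_def]
      ring
    rw [h]
    simp_rw [hF]
    rw [← Finset.sum_mul]
    have : ∑ b, y b b = 0 := hy
    rw [this, zero_mul]
  have h1 := orbitMoment_le_of_diag_eq_zero N _ hoff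
  have h2 := orbitMoment_le_of_diag_eq_zero N _ hdiag
  rw [orbitMoment_conjBy, frobSq_conjBy] at h2
  have h3 := orbitMoment_add_le N (y - D) D
  rw [sub_add_cancel] at h3
  have h4 : frobSq (y - D) + frobSq D = frobSq y := by
    simp only [frobSq, ← Finset.sum_add_distrib]
    refine Finset.sum_congr rfl fun a _ => Finset.sum_congr rfl fun b _ => ?_
    by_cases hab : a = b
    · subst hab; simp [hD]
    · simp [hD, hab]
  have hcard : (1 : ℝ) ≤ Fintype.card m := by exact_mod_cast Fintype.card_pos
  have hc0 : (0 : ℝ) ≤ Fintype.card m * (Fintype.card m - 1) :=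
    mul_nonneg (by linarith) (by linarith)
  have h5 := mul_le_mul_of_nonneg_left h3 hc0
  rw [← h4]
  linarith

end Moments

/-! ### Functions of bounded bidegree on the unitary group -/

section Bidegree

variable {m : Type*} [Fintype m] [DecidableEq m]

/-- `HasBidegree s t f`: the function `f` on the unitary group is built by sums and products from
constants, at most `s` matrix elements and at most `t` conjugate matrix elements in each product. -/
inductive HasBidegree : ℕ → ℕ → (unitaryGroup m ℂ → ℂ) → Prop
  | const (s t : ℕ) (c : ℂ) : HasBidegree s t fun _ => c
  | entry (a b : m) : HasBidegree 1 0 fun U => (U : Matrix m m ℂ) a b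
  | star_entry (a b : m) : HasBidegree 0 1 fun U => star ((U : Matrix m m ℂ) a b)
  | add {s t : ℕ} {f g : unitaryGroup m ℂ → ℂ} :
      HasBidegree s t f → HasBidegree s t g → HasBidegree s t fun U => f U + g U
  | mul {s t s' t' : ℕ} {f g : unitaryGroup m ℂ → ℂ} :
      HasBidegree s t f → HasBidegree s' t' g → HasBidegree (s + s') (t + t') fun U => f U * g U

namespace HasBidegree

variable {s t s' t' : ℕ} {f g : unitaryGroup m ℂ → ℂ}

theorem exists_polyVal (hf : HasBidegree s t f) :
    ∃ p : MvPolynomial ((m × m) ⊕ (m × m)) ℂ,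
      (∀ d ∈ p.support, ∑ e, d (Sum.inl e) ≤ s ∧ ∑ e, d (Sum.inr e) ≤ t) ∧
      ∀ U, polyVal p U = f U := by
  classical
  induction hf with
  | const s t c =>
    refine ⟨MvPolynomial.C c, fun d hd => ?_, fun U => by simp [polyVal]⟩
    have : d = 0 := by
      by_contra h
      simp [MvPolynomial.coeff_C, Ne.symm h] at hd
    simp [this]
  | entry a b =>
    refine ⟨MvPolynomial.X (Sum.inl (a, b)), fun d hd => ?_, fun U => by simp [polyVal]⟩
    rw [MvPolynomial.support_X, Finset.mem_singleton] at hd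
    subst hd
    simp [Finsupp.single_apply]
  | star_entry a b =>
    refine ⟨MvPolynomial.X (Sum.inr (b, a)), fun d hd => ?_, fun U => by simp [polyVal]⟩
    rw [MvPolynomial.support_X, Finset.mem_singleton] at hd
    subst hd
    simp [Finsupp.single_apply]
  | add _ _ hf hg =>
    obtain ⟨p, hp, hp'⟩ := hf
    obtain ⟨q, hq, hq'⟩ := hg
    refine ⟨p + q, fun d hd => ?_, fun U => by simp [← hp', ← hq', polyVal]⟩
    rcases Finset.mem_union.1 (MvPolynomial.support_add hd) with h | h
    · exact hp d h
    · exact hq d h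
  | mul _ _ hf hg =>
    obtain ⟨p, hp, hp'⟩ := hf
    obtain ⟨q, hq, hq'⟩ := hg
    refine ⟨p * q, fun d hd => ?_, fun U => by simp [← hp', ← hq', polyVal]⟩
    obtain ⟨d₁, h₁, d₂, h₂, rfl⟩ := Finset.mem_add.1 (MvPolynomial.support_mul p q hd)
    have := hp d₁ h₁
    have := hq d₂ h₂
    simp only [Finsupp.add_apply, Finset.sum_add_distrib]
    omega

protected theorem star (hf : HasBidegree s t f) : HasBidegree t s fun U => star (f U) := by
  induction hf with
  | const s t c => exact const t s (star c)
  | entry a b => exact star_entry a b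
  | star_entry a b => simpa using entry a b
  | add _ _ hf hg => simpa using hf.add hg
  | mul _ _ hf hg => simpa using hf.mul hg

protected theorem const_mul (c : ℂ) (hf : HasBidegree s t f) :
    HasBidegree s t fun U => c * f U := by
  simpa using (const 0 0 c).mul hf

protected theorem sub (hf : HasBidegree s t f) (hg : HasBidegree s t g) :
    HasBidegree s t fun U => f U - g U := by
  simpa [sub_eq_add_neg] using hf.add (hg.const_mul (-1))

protected theorem sum {κ : Type*} (S : Finset κ) {F : κ → unitaryGroup m ℂ → ℂ}
    (hF : ∀ k, HasBidegree s t (F k)) : HasBidegree s t fun U => ∑ k ∈ S, F k U := by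
  classical
  induction S using Finset.induction_on with
  | empty => simpa using const s t 0
  | insert k S hk ih => simpa [Finset.sum_insert hk] using (hF k).add ih

end HasBidegree

/-- All entries of a matrix-valued function on the unitary group have the given bidegree. -/
def MatHasBidegree {ι κ : Type*} (s t : ℕ) (F : unitaryGroup m ℂ → Matrix ι κ ℂ) : Prop :=
  ∀ i k, HasBidegree s t fun U => F U i k

namespace MatHasBidegree

variable {ι κ τ : Type*} {s t s' t' : ℕ}

protected theorem const (M : Matrix ι κ ℂ) :
    MatHasBidegree 0 0 fun _ : unitaryGroup m ℂ => M :=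
  fun i k => HasBidegree.const 0 0 (M i k)

theorem coe : MatHasBidegree 1 0 fun U : unitaryGroup m ℂ => (U : Matrix m m ℂ) :=
  HasBidegree.entry

protected theorem mul [Fintype κ] {F : unitaryGroup m ℂ → Matrix ι κ ℂ}
    {G : unitaryGroup m ℂ → Matrix κ τ ℂ} (hF : MatHasBidegree s t F)
    (hG : MatHasBidegree s' t' G) : MatHasBidegree (s + s') (t + t') fun U => F U * G U := by
  intro i k
  simp only [mul_apply]
  exact HasBidegree.sum _ fun l => (hF i l).mul (hG l k)

protected theorem conjTranspose {F : unitaryGroup m ℂ → Matrix ι κ ℂ}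
    (hF : MatHasBidegree s t F) : MatHasBidegree t s fun U => (F U)ᴴ :=
  fun i k => (hF k i).star

protected theorem trace [Fintype ι] {F : unitaryGroup m ℂ → Matrix ι ι ℂ}
    (hF : MatHasBidegree s t F) : HasBidegree s t fun U => trace (F U) :=
  HasBidegree.sum _ fun i => hF i i

end MatHasBidegree

theorem IsUnitaryDesign.integral_eq {Ω : Type*} [MeasurableSpace Ω] {P : Measure Ω} {t : ℕ}
    {X : Ω → unitaryGroup m ℂ} (hX : IsUnitaryDesign t X P) {f : unitaryGroup m ℂ → ℂ}
    (hf : HasBidegree t t f) : ∫ ω, f (X ω) ∂P = ∫ U, f U ∂(haarUnitary m) := by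
  obtain ⟨p, hp, hp'⟩ := hf.exists_polyVal
  simpa [hp'] using hX p hp

end Bidegree

/-! ### Integration over independent unitaries, one coordinate at a time -/

section Resampling

variable {ι : Type*} [Fintype ι] [DecidableEq ι]

theorem map_update_pi_prod {α : Type*} [MeasurableSpace α] (μ : ι → Measure α)
    [∀ i, IsProbabilityMeasure (μ i)] (o : ι) (ν : Measure α) [IsProbabilityMeasure ν] :
    ((Measure.pi μ).prod ν).map (fun p => Function.update p.1 o p.2)
      = Measure.pi (Function.update μ o ν) := by
  have : ∀ i, IsProbabilityMeasure (Function.update μ o ν i) := by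
    intro i
    by_cases h : i = o
    · subst h; simpa
    · simpa [h] using inferInstanceAs (IsProbabilityMeasure (μ i))
  have hmeas : Measurable fun p : (ι → α) × α => Function.update p.1 o p.2 :=
    measurable_pi_iff.2 fun i => by
      by_cases h : i = o
      · subst h; simpa using measurable_snd
      · simpa [h, Function.comp_def] using (measurable_pi_apply i).comp measurable_fst
  symm
  refine Measure.pi_eq fun s hs => ?_
  rw [Measure.map_apply hmeas (MeasurableSet.univ_pi hs)]
  have hpre : (fun p : (ι → α) × α => Function.update p.1 o p.2) ⁻¹' Set.univ.pi s
      = (Set.univ.pi (Function.update s o Set.univ)) ×ˢ s o := by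
    ext p
    simp only [Set.mem_preimage, Set.mem_pi, Set.mem_univ, forall_true_left, Set.mem_prod]
    constructor
    · intro h
      refine ⟨fun i => ?_, by simpa using h o⟩
      by_cases hi : i = o
      · subst hi; simp
      · simpa [hi] using h i
    · rintro ⟨h, h'⟩ i
      by_cases hi : i = o
      · subst hi; simpa using h'
      · simpa [hi] using h i
  rw [hpre, Measure.prod_prod, Measure.pi_pi,
    ← Finset.mul_prod_erase Finset.univ (fun i => Function.update μ o ν i (s i))
      (Finset.mem_univ o),
    ← Finset.mul_prod_erase Finset.univ (fun i => μ i (Function.update s o Set.univ i))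
      (Finset.mem_univ o)]
  simp only [Function.update_self, measure_univ, one_mul]
  rw [mul_comm]
  congr 1
  refine Finset.prod_congr rfl fun i hi => ?_
  rw [Function.update_of_ne (Finset.ne_of_mem_erase hi),
    Function.update_of_ne (Finset.ne_of_mem_erase hi)]

variable {m : Type*} [Fintype m] [DecidableEq m]

theorem integral_pi_update {E : Type*} [NormedAddCommGroup E] [NormedSpace ℝ E]
    [SecondCountableTopology E] (μ : ι → Measure (unitaryGroup m ℂ))
    [∀ i, IsProbabilityMeasure (μ i)] (o : ι)
    (ν : Measure (unitaryGroup m ℂ)) [IsProbabilityMeasure ν]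
    {F : (ι → unitaryGroup m ℂ) → E} (hF : Continuous F) :
    ∫ x, F x ∂(Measure.pi (Function.update μ o ν))
      = ∫ x, ∫ u, F (Function.update x o u) ∂ν ∂(Measure.pi μ) := by
  have hc : Continuous fun p : (ι → unitaryGroup m ℂ) × unitaryGroup m ℂ =>
      Function.update p.1 o p.2 := continuous_fst.update o continuous_snd
  rw [← map_update_pi_prod, integral_map hc.measurable.aemeasurable
    hF.aestronglyMeasurable]
  exact integral_prod _ (integrable_of_continuous (hF.comp hc))

/-- Coordinates of a product measure may be resampled. -/
theorem integral_pi_resample {E : Type*} [NormedAddCommGroup E] [NormedSpace ℝ E]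
    [SecondCountableTopology E] (μ : ι → Measure (unitaryGroup m ℂ))
    [∀ i, IsProbabilityMeasure (μ i)] (o : ι)
    {F : (ι → unitaryGroup m ℂ) → E} (hF : Continuous F) :
    ∫ x, F x ∂(Measure.pi μ)
      = ∫ x, ∫ u, F (Function.update x o u) ∂(μ o) ∂(Measure.pi μ) := by
  conv_lhs => rw [← Function.update_eq_self o μ]
  exact integral_pi_update μ o (μ o) hF

/-- A function that has bidegree `(t, t)` in each of several independent `t`-designs has the same
average as over independent Haar unitaries: the designs are replaced one at a time. -/
theorem integral_designs_eq_integral_haar {Ω : Type*} [MeasurableSpace Ω] {P : Measure Ω}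
    [IsProbabilityMeasure P] {t : ℕ} {X : ι → Ω → unitaryGroup m ℂ}
    (hmeas : ∀ o, Measurable (X o)) (hind : iIndepFun X P)
    (hX : ∀ o, IsUnitaryDesign t (X o) P) {F : (ι → unitaryGroup m ℂ) → ℂ} (hF : Continuous F)
    (hdeg : ∀ x o, HasBidegree t t fun u => F (Function.update x o u)) :
    ∫ ω, F (fun o => X o ω) ∂P = ∫ x, F x ∂(Measure.pi fun _ : ι => haarUnitary m) := by
  have hP : ∀ o, IsProbabilityMeasure (P.map (X o)) := fun o =>
    Measure.isProbabilityMeasure_map (hmeas o).aemeasurable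
  -- The blocks in `S` are Haar distributed, the others still have their original laws.
  have key : ∀ S : Finset ι, ∫ x, F x ∂(Measure.pi fun o => P.map (X o))
      = ∫ x, F x ∂(Measure.pi fun o => if o ∈ S then haarUnitary m else P.map (X o)) := by
    intro S
    induction S using Finset.induction_on with
    | empty => simp
    | insert o S ho ih =>
      rw [ih]
      set μ : ι → Measure (unitaryGroup m ℂ) :=
        fun o => if o ∈ S then haarUnitary m else P.map (X o) with hμ
      have : ∀ i, IsProbabilityMeasure (μ i) := by
        intro i
        simp only [hμ]
        split_ifs
        · infer_instance
        · exact hP i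
      have h1 : (fun i => if i ∈ insert o S then haarUnitary m else P.map (X i))
          = Function.update μ o (haarUnitary m) := by
        ext1 i
        by_cases hi : i = o
        · subst hi; simp
        · simp [hi, hμ]
      have h2 : μ o = P.map (X o) := by simp [hμ, ho]
      rw [h1, integral_pi_update μ o _ hF, integral_pi_resample μ o hF, h2]
      congr 1
      ext x
      have hc : Continuous fun u => F (Function.update x o u) :=
        hF.comp (continuous_const.update o continuous_id)
      rw [integral_map (hmeas o).aemeasurable hc.aestronglyMeasurable]
      exact (hX o).integral_eq (hdeg x o)
  have h := key Finset.univ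
  simp only [Finset.mem_univ, if_true] at h
  rw [← h, ← (iIndepFun_iff_map_fun_eq_pi_map fun o => (hmeas o).aemeasurable).1 hind,
    integral_map (measurable_pi_iff.2 hmeas).aemeasurable hF.aestronglyMeasurable]

/-- Left invariance of Haar measure, for a translation that depends on another coordinate. -/
theorem integral_pi_haar_shear {E : Type*} [NormedAddCommGroup E] [NormedSpace ℝ E]
    [SecondCountableTopology E] {o o' : ι} (hne : o' ≠ o)
    {F : (ι → unitaryGroup m ℂ) → E} (hF : Continuous F) :
    ∫ x, F x ∂(Measure.pi fun _ : ι => haarUnitary m)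
      = ∫ x, F (Function.update x o ((x o')⁻¹ * x o))
          ∂(Measure.pi fun _ : ι => haarUnitary m) := by
  have hc : Continuous fun x : ι → unitaryGroup m ℂ =>
      F (Function.update x o ((x o')⁻¹ * x o)) :=
    hF.comp (continuous_id.update o
      ((continuous_apply o').inv.mul (continuous_apply o)))
  rw [integral_pi_resample _ o hF, integral_pi_resample _ o hc]
  congr 1
  ext x
  simp only [Function.update_self, Function.update_of_ne hne, Function.update_idem]
  exact (integral_mul_left_eq_self (fun u => F (Function.update x o u)) (x o')⁻¹).symm

end Resampling

/-! ### Operators on the register -/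

section Register

variable {n : ℕ}

/-- The register split into the qubits on which the `j`-th perceptron acts and the other output
qubits. -/
def splitOut (j : Fin n) : Qubits n × Qubits n ≃ PQubits n × ({k // k ≠ j} → Fin 2) :=
  ((Equiv.refl _).prodCongr (Equiv.funSplitAt j (Fin 2))).trans (Equiv.prodAssoc _ _ _).symm

theorem splitOut_symm_update (j : Fin n) (p : PQubits n) (a : Qubits n × Qubits n) :
    (splitOut j).symm (p, (splitOut j a).2) = (p.1, Function.update a.2 j p.2) := by
  refine Prod.ext rfl (funext fun k => ?_)
  by_cases h : k = j
  · subst h; simp [splitOut]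
  · simp [splitOut, h]

theorem onInOut_eq (j : Fin n) (M : Matrix (PQubits n) (PQubits n) ℂ) :
    onInOut j M = (M ⊗ₖ (1 : Matrix ({k // k ≠ j} → Fin 2) _ ℂ)).submatrix
      (splitOut j) (splitOut j) := by
  ext a b
  simp [onInOut, splitOut, one_apply, funext_iff, Subtype.forall]

theorem onInOut_mul (j : Fin n) (M M' : Matrix (PQubits n) (PQubits n) ℂ) :
    onInOut j (M * M') = onInOut j M * onInOut j M' := by
  rw [onInOut_eq, onInOut_eq, onInOut_eq, submatrix_mul_equiv, ← mul_kronecker_mul, Matrix.one_mul]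

theorem onInOut_one (j : Fin n) : onInOut j 1 = 1 := by
  rw [onInOut_eq, one_kronecker_one, submatrix_one_equiv]

theorem onInOut_conjTranspose (j : Fin n) (M : Matrix (PQubits n) (PQubits n) ℂ) :
    (onInOut j M)ᴴ = onInOut j Mᴴ := by
  rw [onInOut_eq, onInOut_eq, conjTranspose_submatrix, conjTranspose_kronecker, conjTranspose_one]

theorem onInOut_smul (j : Fin n) (c : ℂ) (M : Matrix (PQubits n) (PQubits n) ℂ) :
    onInOut j (c • M) = c • onInOut j M := by
  ext a b; simp [onInOut]

theorem onInOut_mem_unitary (j : Fin n) (U : unitaryGroup (PQubits n) ℂ) :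
    onInOut j (U : Matrix (PQubits n) (PQubits n) ℂ)
      ∈ unitaryGroup (Qubits n × Qubits n) ℂ := by
  rw [mem_unitaryGroup_iff, star_eq_conjTranspose, onInOut_conjTranspose, ← onInOut_mul,
    unitary_mul_conjTranspose, onInOut_one]

theorem onInOut_mul_apply {ι : Type*} (j : Fin n) (M : Matrix (PQubits n) (PQubits n) ℂ)
    (N : Matrix (Qubits n × Qubits n) ι ℂ) (a : Qubits n × Qubits n) (i : ι) :
    (onInOut j M * N) a i
      = ∑ p, M (a.1, a.2 j) p * N (p.1, Function.update a.2 j p.2) i := by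
  rw [onInOut_eq, mul_apply, ← (splitOut j).symm.sum_comp, Fintype.sum_prod_type]
  refine Finset.sum_congr rfl fun p _ => ?_
  rw [Finset.sum_eq_single (splitOut j a).2]
  · rw [submatrix_apply, Equiv.apply_symm_apply, kroneckerMap_apply, one_apply_eq, mul_one,
      splitOut_symm_update]
    rfl
  · intro r _ hr
    simp [one_apply, Ne.symm hr]
  · simp

theorem mul_onInOut_conjTranspose_apply {ι : Type*} (j : Fin n)
    (M : Matrix (PQubits n) (PQubits n) ℂ)
    (N : Matrix ι (Qubits n × Qubits n) ℂ) (i : ι) (b : Qubits n × Qubits n) :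
    (N * (onInOut j M)ᴴ) i b
      = ∑ p, N i (p.1, Function.update b.2 j p.2) * Mᴴ p (b.1, b.2 j) := by
  have h := congrArg star (onInOut_mul_apply j M Nᴴ b i)
  rw [← conjTranspose_apply, conjTranspose_mul, conjTranspose_conjTranspose] at h
  rw [h, star_sum]
  refine Finset.sum_congr rfl fun p _ => ?_
  simp [mul_comm]

/-- The partial trace over all qubits on which the `j`-th perceptron does not act. -/
def traceRest (j : Fin n) (Y : Matrix (Qubits n × Qubits n) (Qubits n × Qubits n) ℂ) :
    Matrix (PQubits n) (PQubits n) ℂ :=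
  Matrix.of fun p q => ∑ r, Y ((splitOut j).symm (p, r)) ((splitOut j).symm (q, r))

theorem trace_mul_onInOut (j : Fin n) (Y : Matrix (Qubits n × Qubits n) (Qubits n × Qubits n) ℂ)
    (H : Matrix (PQubits n) (PQubits n) ℂ) :
    trace (Y * onInOut j H) = trace (traceRest j Y * H) := by
  rw [show trace (Y * onInOut j H) = ∑ a, (Y * onInOut j H) a a from rfl,
    ← (splitOut j).symm.sum_comp, Fintype.sum_prod_type]
  simp only [trace, diag_apply, mul_apply, traceRest, of_apply, Finset.sum_mul]
  refine Finset.sum_congr rfl fun p _ => ?_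
  rw [Finset.sum_comm (s := (Finset.univ : Finset (PQubits n)))]
  refine Finset.sum_congr rfl fun r _ => ?_
  rw [← (splitOut j).symm.sum_comp (fun a => Y ((splitOut j).symm (p, r)) a
    * onInOut j H a ((splitOut j).symm (p, r))), Fintype.sum_prod_type]
  refine Finset.sum_congr rfl fun q _ => ?_
  rw [Finset.sum_eq_single r]
  · simp [onInOut_eq]
  · intro r' _ hr'
    simp [onInOut_eq, one_apply, hr']
  · simp

theorem trace_traceRest (j : Fin n)
    (Y : Matrix (Qubits n × Qubits n) (Qubits n × Qubits n) ℂ) :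
    trace (traceRest j Y) = trace Y := by
  have := trace_mul_onInOut j Y 1
  rwa [onInOut_one, Matrix.mul_one, Matrix.mul_one, eq_comm] at this

theorem traceRest_sub (j : Fin n) (Y Z : Matrix (Qubits n × Qubits n) (Qubits n × Qubits n) ℂ) :
    traceRest j (Y - Z) = traceRest j Y - traceRest j Z := by
  ext p q; simp [traceRest, Finset.sum_sub_distrib]

/-- A partial trace of the rank one operator `|v⟩⟨w|` has Frobenius norm at most `‖v‖ ‖w‖`, by
Cauchy–Schwarz in each entry. -/
theorem frobSq_traceRest_le (j : Fin n) (v w : Matrix (Qubits n × Qubits n) Unit ℂ) :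
    frobSq (traceRest j (v * wᴴ)) ≤ frobSq v * frobSq w := by
  have hsplit : ∀ u : Matrix (Qubits n × Qubits n) Unit ℂ,
      frobSq u = ∑ p, ∑ r, ‖u ((splitOut j).symm (p, r)) ()‖ ^ 2 := by
    intro u
    simp only [frobSq, Finset.univ_unique, Finset.sum_singleton]
    rw [← (splitOut j).symm.sum_comp, Fintype.sum_prod_type]
  rw [hsplit v, hsplit w, Finset.sum_mul_sum, frobSq]
  refine Finset.sum_le_sum fun p _ => Finset.sum_le_sum fun q _ => ?_
  have h1 : ‖traceRest j (v * wᴴ) p q‖ ≤ ∑ r, ‖v ((splitOut j).symm (p, r)) ()‖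
      * ‖w ((splitOut j).symm (q, r)) ()‖ := by
    refine (norm_sum_le _ _).trans_eq (Finset.sum_congr rfl fun r _ => ?_)
    simp [mul_apply]
  exact (pow_le_pow_left₀ (norm_nonneg _) h1 2).trans (Finset.sum_mul_sq_le_sq_mul_sq _ _ _)

/-- An operator on the output qubits, extended by the identity on the input qubits. -/
def onOut (K : Matrix (Qubits n) (Qubits n) ℂ) :
    Matrix (Qubits n × Qubits n) (Qubits n × Qubits n) ℂ :=
  (1 : Matrix (Qubits n) (Qubits n) ℂ) ⊗ₖ K

theorem trace_mul_traceIn (K : Matrix (Qubits n) (Qubits n) ℂ)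
    (M : Matrix (Qubits n × Qubits n) (Qubits n × Qubits n) ℂ) :
    trace (K * traceIn M) = trace (onOut K * M) := by
  simp only [trace, diag_apply, mul_apply, traceIn, of_apply, onOut, kroneckerMap_apply,
    Fintype.sum_prod_type, one_apply, ite_mul, one_mul, zero_mul, Finset.mul_sum]
  simp only [Finset.sum_ite_irrel, Finset.sum_const_zero, Finset.sum_ite_eq, Finset.mem_univ,
    if_true]
  conv_rhs => rw [Finset.sum_comm]
  refine Finset.sum_congr rfl fun x _ => ?_
  rw [Finset.sum_comm]

theorem onOut_mul (K K' : Matrix (Qubits n) (Qubits n) ℂ) :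
    onOut (K * K') = onOut K * onOut K' := by
  rw [onOut, onOut, onOut, ← mul_kronecker_mul, Matrix.one_mul]

theorem onOut_conjTranspose (K : Matrix (Qubits n) (Qubits n) ℂ) : (onOut K)ᴴ = onOut Kᴴ := by
  rw [onOut, onOut, conjTranspose_kronecker, conjTranspose_one]

theorem onOut_one : onOut (1 : Matrix (Qubits n) (Qubits n) ℂ) = 1 := one_kronecker_one

/-- The initial state `|φ⟩ ⊗ |0…0⟩` of the register, as a column. -/
def initialKet (φ : EuclideanSpace ℂ (Qubits n)) : Matrix (Qubits n × Qubits n) Unit ℂ :=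
  Matrix.of fun a _ => φ a.1 * zeroKet n a.2

theorem initialKet_mul_conjTranspose (φ : EuclideanSpace ℂ (Qubits n)) :
    initialKet φ * (initialKet φ)ᴴ = kroneckerMap (· * ·) (ketbra φ) (ketbra (zeroKet n)) := by
  ext a b
  simp only [mul_apply, initialKet, of_apply, conjTranspose_apply, kroneckerMap_apply, ketbra,
    Finset.univ_unique, Finset.sum_singleton, star_mul']
  ring

theorem sum_mul_star_self {ι : Type*} [Fintype ι] (φ : EuclideanSpace ℂ ι) (hφ : ‖φ‖ = 1) :
    ∑ a, φ a * star (φ a) = 1 := by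
  have h := EuclideanSpace.norm_sq_eq φ
  rw [hφ, one_pow] at h
  simp only [RCLike.star_def, Complex.mul_conj, Complex.normSq_eq_norm_sq]
  exact_mod_cast h.symm

theorem frobSq_initialKet (φ : EuclideanSpace ℂ (Qubits n)) (hφ : ‖φ‖ = 1) :
    frobSq (initialKet φ) = 1 := by
  have h : (frobSq (initialKet φ) : ℂ) = 1 := by
    rw [ofReal_frobSq, initialKet_mul_conjTranspose, trace_kronecker]
    simp only [trace, diag_apply, ketbra, of_apply, sum_mul_star_self φ hφ]
    simp [zeroKet]
  exact_mod_cast h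

theorem traceIn_initialKet (φ : EuclideanSpace ℂ (Qubits n)) (hφ : ‖φ‖ = 1) (x y : Qubits n) :
    traceIn (initialKet φ * (initialKet φ)ᴴ) x y = if x = y ∧ ∀ i, x i = 0 then 1 else 0 := by
  rw [initialKet_mul_conjTranspose]
  simp only [traceIn, of_apply, kroneckerMap_apply, ← Finset.sum_mul]
  have h : ∑ a, ketbra φ a a = 1 := sum_mul_star_self φ hφ
  rw [h, one_mul]
  have hx : (∀ i, x i = 0) ↔ x = 0 := by simp [funext_iff]
  simp only [hx]
  by_cases h0 : x = 0
  · subst h0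
    by_cases hy : y = 0
    · subst hy; simp [ketbra, zeroKet]
    · simp [ketbra, zeroKet, hy, Ne.symm hy]
  · simp [ketbra, zeroKet, h0]

theorem frobSq_mul_of_conjTranspose_mul_eq_one {ι κ : Type*} [Fintype ι] [Fintype κ]
    [DecidableEq ι] {U : Matrix ι ι ℂ} (hU : Uᴴ * U = 1) (M : Matrix ι κ ℂ) :
    frobSq (U * M) = frobSq M := by
  have h : (frobSq (U * M) : ℂ) = frobSq M := by
    rw [ofReal_frobSq, ofReal_frobSq, conjTranspose_mul, trace_mul_comm, Matrix.mul_assoc,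
      ← Matrix.mul_assoc Uᴴ, hU, Matrix.one_mul, trace_mul_comm]
  exact_mod_cast h

end Register

/-! ### Products of perceptrons and their first moments -/

section Network

variable {n : ℕ}

/-- The product over the list `l` of the operators `W k`, each acting on the input qubits and the
`k`-th output qubit. -/
def orderedProd (l : List (Fin n)) (W : Fin n → Matrix (PQubits n) (PQubits n) ℂ) :
    Matrix (Qubits n × Qubits n) (Qubits n × Qubits n) ℂ :=
  (l.map fun k => onInOut k (W k)).prod

theorem network_eq_orderedProd (V : Fin n → unitaryGroup (PQubits n) ℂ) :
    network V = orderedProd (List.finRange n).reverse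
      fun k => (V k : Matrix (PQubits n) (PQubits n) ℂ) := by
  rw [network, orderedProd, List.ofFn_eq_map, List.map_reverse]

theorem orderedProd_congr {l : List (Fin n)} {W W' : Fin n → Matrix (PQubits n) (PQubits n) ℂ}
    (h : ∀ k ∈ l, W k = W' k) : orderedProd l W = orderedProd l W' := by
  unfold orderedProd
  congr 1
  exact List.map_congr_left fun k hk => by rw [h k hk]

theorem orderedProd_append_cons (l₁ l₂ : List (Fin n)) (j : Fin n)
    (W : Fin n → Matrix (PQubits n) (PQubits n) ℂ) :
    orderedProd (l₁ ++ j :: l₂) W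
      = orderedProd l₁ W * onInOut j (W j) * orderedProd l₂ W := by
  simp [orderedProd, Matrix.mul_assoc]

/-- The perceptrons act in increasing order, so that the product runs over the reversed list; `l₁`
holds the perceptrons that act after the `j`-th one. -/
theorem exists_split_reverse_finRange (j : Fin n) : ∃ l₁ l₂ : List (Fin n),
    (List.finRange n).reverse = l₁ ++ j :: l₂ ∧ j ∉ l₁ ∧ j ∉ l₂ := by
  have hmem : j ∈ (List.finRange n).reverse := by simp
  obtain ⟨l₁, l₂, h⟩ := List.append_of_mem hmem
  have hnd : (List.finRange n).reverse.Nodup := List.nodup_reverse.2 (List.nodup_finRange n)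
  rw [h, List.nodup_append] at hnd
  refine ⟨l₁, l₂, h, fun hj => ?_, (List.nodup_cons.1 hnd.2.1).1⟩
  exact hnd.2.2 j hj j (by simp) rfl

theorem orderedProd_mem_unitary (l : List (Fin n)) (V : Fin n → unitaryGroup (PQubits n) ℂ) :
    orderedProd l (fun k => (V k : Matrix (PQubits n) (PQubits n) ℂ))
      ∈ unitaryGroup (Qubits n × Qubits n) ℂ := by
  refine Submonoid.list_prod_mem _ fun M hM => ?_
  obtain ⟨k, _, rfl⟩ := List.mem_map.1 hM
  exact onInOut_mem_unitary k (V k)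

theorem continuous_onInOut (j : Fin n) :
    Continuous (onInOut j : Matrix (PQubits n) (PQubits n) ℂ → _) := by
  refine continuous_matrix fun a b => ?_
  unfold onInOut
  simp only [of_apply]
  split_ifs
  · exact continuous_id.matrix_elem _ _
  · exact continuous_const

theorem continuous_orderedProd {X : Type*} [TopologicalSpace X] (l : List (Fin n))
    {W : X → Fin n → Matrix (PQubits n) (PQubits n) ℂ} (hW : ∀ k, Continuous fun x => W x k) :
    Continuous fun x => orderedProd l (W x) :=
  continuous_list_prod l fun k _ => (continuous_onInOut k).comp (hW k)

theorem continuous_traceIn :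
    Continuous (traceIn : Matrix (Qubits n × Qubits n) (Qubits n × Qubits n) ℂ → _) := by
  refine continuous_matrix fun a b => ?_
  unfold traceIn
  simp only [of_apply]
  exact continuous_finsetSum _ fun c _ => continuous_id.matrix_elem _ _

/-- One Haar random perceptron makes the `k`-th output qubit maximally mixed. -/
theorem integral_traceIn_onInOut (k : Fin n)
    (M : Matrix (Qubits n × Qubits n) (Qubits n × Qubits n) ℂ) (x y : Qubits n) :
    ∫ U : unitaryGroup (PQubits n) ℂ,
        traceIn (onInOut k (U : Matrix (PQubits n) (PQubits n) ℂ) * M * (onInOut k (U : _))ᴴ) x y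
        ∂(haarUnitary (PQubits n))
      = if x k = y k then
          (1 / 2 : ℂ) * ∑ e, traceIn M (Function.update x k e) (Function.update y k e) else 0 := by
  -- The block of `M` seen by the perceptron when the other output qubits have the values of `x`, `y`.
  set N : Matrix (PQubits n) (PQubits n) ℂ := Matrix.of fun p q =>
    M (p.1, Function.update x k p.2) (q.1, Function.update y k q.2) with hN
  have hentry : ∀ (U : unitaryGroup (PQubits n) ℂ) (a : Qubits n),
      (onInOut k (U : Matrix (PQubits n) (PQubits n) ℂ) * M
        * (onInOut k (U : Matrix (PQubits n) (PQubits n) ℂ))ᴴ) (a, x) (a, y)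
      = conjBy U N (a, x k) (a, y k) := by
    intro U a
    rw [mul_onInOut_conjTranspose_apply, conjBy, mul_apply]
    refine Finset.sum_congr rfl fun q _ => ?_
    rw [onInOut_mul_apply, mul_apply]
    rfl
  have htr : trace N = ∑ e, traceIn M (Function.update x k e) (Function.update y k e) := by
    simp only [trace, diag_apply, hN, of_apply, Fintype.sum_prod_type, traceIn]
    rw [Finset.sum_comm]
  simp only [traceIn, of_apply, hentry]
  rw [integral_finsetSum _ fun a _ => integrable_of_continuous (by fun_prop)]
  simp only [integral_conjBy_apply, Prod.mk.injEq, true_and]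
  split_ifs with h
  · rw [htr]
    simp only [Finset.sum_const, Finset.card_univ, Fintype.card_prod, Fintype.card_fun,
      Fintype.card_fin, nsmul_eq_mul]
    push_cast
    simp only [traceIn, of_apply]
    field_simp
  · simp

/-- Averaging over Haar random perceptrons turns their output qubits into maximally mixed ones and
leaves the other output qubits in the state `|0⟩`. -/
theorem integral_traceIn_orderedProd (φ : EuclideanSpace ℂ (Qubits n)) (hφ : ‖φ‖ = 1)
    (l : List (Fin n)) (hl : l.Nodup) (x y : Qubits n) :
    ∫ b : Option (Fin n) → unitaryGroup (PQubits n) ℂ,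
        traceIn (orderedProd l (fun k => (b (some k) : Matrix (PQubits n) (PQubits n) ℂ))
          * (initialKet φ * (initialKet φ)ᴴ)
          * (orderedProd l (fun k => (b (some k) : Matrix (PQubits n) (PQubits n) ℂ)))ᴴ) x y
        ∂(Measure.pi fun _ => haarUnitary (PQubits n))
      = if x = y ∧ ∀ i, i ∉ l → x i = 0 then (1 / 2 : ℂ) ^ l.length else 0 := by
  induction l generalizing x y with
  | nil => simp [orderedProd, traceIn_initialKet φ hφ]
  | cons k l ih =>
    obtain ⟨hk, hl⟩ := List.nodup_cons.1 hl
    have hcont : ∀ l : List (Fin n), Continuous fun b : Option (Fin n) →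
        unitaryGroup (PQubits n) ℂ =>
        (orderedProd l (fun k => (b (some k) : Matrix (PQubits n) (PQubits n) ℂ))
          * (initialKet φ * (initialKet φ)ᴴ)
          * (orderedProd l (fun k => (b (some k) : Matrix (PQubits n) (PQubits n) ℂ)))ᴴ) := by
      intro l
      have := continuous_orderedProd l (X := Option (Fin n) → unitaryGroup (PQubits n) ℂ)
        (W := fun b k => (b (some k) : Matrix (PQubits n) (PQubits n) ℂ))
        (fun k => by fun_prop)
      fun_prop
    have hcont' : ∀ (l : List (Fin n)) (x y : Qubits n), Continuous fun b : Option (Fin n) →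
        unitaryGroup (PQubits n) ℂ =>
        traceIn (orderedProd l (fun k => (b (some k) : Matrix (PQubits n) (PQubits n) ℂ))
          * (initialKet φ * (initialKet φ)ᴴ)
          * (orderedProd l (fun k => (b (some k) : Matrix (PQubits n) (PQubits n) ℂ)))ᴴ) x y :=
      fun l x y => (continuous_traceIn.comp (hcont l)).matrix_elem x y
    rw [integral_pi_resample _ (some k) (hcont' (k :: l) x y)]
    have hstep : ∀ (b : Option (Fin n) → unitaryGroup (PQubits n) ℂ)
        (u : unitaryGroup (PQubits n) ℂ),
        orderedProd (k :: l) (fun i => (Function.update b (some k) u (some i) :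
          Matrix (PQubits n) (PQubits n) ℂ))
        = onInOut k (u : Matrix (PQubits n) (PQubits n) ℂ) * orderedProd l
          (fun i => (b (some i) : Matrix (PQubits n) (PQubits n) ℂ)) := by
      intro b u
      have h := orderedProd_append_cons [] l k (fun i => (Function.update b (some k) u (some i) :
          Matrix (PQubits n) (PQubits n) ℂ))
      rw [List.nil_append] at h
      rw [h]
      simp only [orderedProd, List.map_nil, List.prod_nil, Matrix.one_mul, Function.update_self]
      congr 1
      refine orderedProd_congr fun i hi => ?_
      rw [Function.update_of_ne]
      rintro ⟨⟩
      exact hk hi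
    simp only [hstep, conjTranspose_mul]
    have hinner : ∀ b : Option (Fin n) → unitaryGroup (PQubits n) ℂ, _ := fun b =>
      integral_traceIn_onInOut k
        (orderedProd l (fun k => (b (some k) : Matrix (PQubits n) (PQubits n) ℂ))
          * (initialKet φ * (initialKet φ)ᴴ)
          * (orderedProd l (fun k => (b (some k) : Matrix (PQubits n) (PQubits n) ℂ)))ᴴ) x y
    simp only [Matrix.mul_assoc] at hinner ih hcont' ⊢
    simp only [hinner]
    by_cases hxy : x k = y k
    · simp only [if_pos hxy]
      rw [integral_const_mul, integral_finsetSum _ fun e _ => integrable_of_continuous (hcont' l _ _)]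
      simp only [ih hl]
      -- The `k`-th output qubit was still in the state `|0⟩`: only `e = 0` contributes to the sum.
      have hiff : ∀ e : Fin 2, ((Function.update x k e = Function.update y k e ∧
          ∀ i, i ∉ l → Function.update x k e i = 0)) ↔
          e = 0 ∧ (x = y ∧ ∀ i, i ∉ k :: l → x i = 0) := by
        intro e
        constructor
        · rintro ⟨h1, h2⟩
          refine ⟨by simpa using h2 k hk, funext fun i => ?_, fun i hi => ?_⟩
          · by_cases hi : i = k
            · rw [hi, hxy]
            · simpa [hi] using congrFun h1 i
          · rw [List.mem_cons, not_or] at hi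
            simpa [hi.1] using h2 i hi.2
        · rintro ⟨rfl, rfl, h⟩
          refine ⟨rfl, fun i hi => ?_⟩
          by_cases hik : i = k
          · subst hik; simp
          · simpa [hik] using h i (by simp [hik, hi])
      simp only [hiff, ite_and]
      rw [Finset.sum_ite_eq' Finset.univ (0 : Fin 2)]
      simp only [Finset.mem_univ, if_true, List.length_cons, pow_succ']
      split_ifs <;> simp
    · have : x ≠ y := fun h => hxy (by rw [h])
      simp [hxy, this]

/-- With Haar random perceptrons the output is maximally mixed on average. -/
theorem integral_frobSq_onOut_network (φ : EuclideanSpace ℂ (Qubits n)) (hφ : ‖φ‖ = 1)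
    (K : Matrix (Qubits n) (Qubits n) ℂ) :
    ∫ b : Option (Fin n) → unitaryGroup (PQubits n) ℂ,
        frobSq (onOut K * (network (fun k => b (some k)) * initialKet φ))
        ∂(Measure.pi fun _ => haarUnitary (PQubits n))
      = (1 / 2) ^ n * frobSq K := by
  have hc : ((∫ b : Option (Fin n) → unitaryGroup (PQubits n) ℂ,
        frobSq (onOut K * (network (fun k => b (some k)) * initialKet φ))
        ∂(Measure.pi fun _ => haarUnitary (PQubits n)) : ℝ) : ℂ)
      = ((1 / 2) ^ n * frobSq K : ℝ) := by
    rw [← integral_complex_ofReal]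
    have h1 : ∀ b : Option (Fin n) → unitaryGroup (PQubits n) ℂ,
        (frobSq (onOut K * (network (fun k => b (some k)) * initialKet φ)) : ℂ)
        = ∑ x, ∑ y, (Kᴴ * K) x y * traceIn (network (fun k => b (some k))
          * (initialKet φ * (initialKet φ)ᴴ) * (network (fun k => b (some k)))ᴴ) y x := by
      intro b
      have h2 : ∑ x, ∑ y, (Kᴴ * K) x y * traceIn (network (fun k => b (some k))
          * (initialKet φ * (initialKet φ)ᴴ) * (network (fun k => b (some k)))ᴴ) y x
          = trace ((Kᴴ * K) * traceIn (network (fun k => b (some k))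
          * (initialKet φ * (initialKet φ)ᴴ) * (network (fun k => b (some k)))ᴴ)) := by
        simp [trace, mul_apply]
      rw [h2, trace_mul_traceIn, onOut_mul, ← onOut_conjTranspose, ofReal_frobSq,
        Matrix.mul_assoc (onOut K)ᴴ, trace_mul_comm (onOut K)ᴴ]
      simp only [conjTranspose_mul, Matrix.mul_assoc]
    simp only [h1]
    have hcont : ∀ x y : Qubits n, Continuous fun b : Option (Fin n) →
        unitaryGroup (PQubits n) ℂ =>
        traceIn (network (fun k => b (some k))
          * (initialKet φ * (initialKet φ)ᴴ) * (network (fun k => b (some k)))ᴴ) y x := by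
      intro x y
      have := continuous_orderedProd (List.finRange n).reverse
        (X := Option (Fin n) → unitaryGroup (PQubits n) ℂ)
        (W := fun b k => (b (some k) : Matrix (PQubits n) (PQubits n) ℂ))
        (fun k => by fun_prop)
      simp only [network_eq_orderedProd]
      exact (continuous_traceIn.comp (by fun_prop)).matrix_elem y x
    have hint : ∀ x y : Qubits n, Integrable (fun b : Option (Fin n) →
        unitaryGroup (PQubits n) ℂ =>
        (Kᴴ * K) x y * traceIn (network (fun k => b (some k))
          * (initialKet φ * (initialKet φ)ᴴ) * (network (fun k => b (some k)))ᴴ) y x)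
        (Measure.pi fun _ => haarUnitary (PQubits n)) :=
      fun x y => (integrable_of_continuous (hcont x y)).const_mul _
    rw [integral_finsetSum _ fun x _ => integrable_finsetSum _ fun y _ => hint x y]
    have h3 : ∀ x y : Qubits n, ∫ b : Option (Fin n) → unitaryGroup (PQubits n) ℂ,
        (Kᴴ * K) x y * traceIn (network (fun k => b (some k))
          * (initialKet φ * (initialKet φ)ᴴ) * (network (fun k => b (some k)))ᴴ) y x
        ∂(Measure.pi fun _ => haarUnitary (PQubits n))
        = if y = x then (Kᴴ * K) x y * (1 / 2) ^ n else 0 := by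
      intro x y
      rw [integral_const_mul]
      simp only [network_eq_orderedProd]
      rw [integral_traceIn_orderedProd φ hφ _ (List.nodup_reverse.2 (List.nodup_finRange n))]
      simp
    rw [Finset.sum_congr rfl fun x _ => integral_finsetSum _ fun y _ => hint x y]
    simp only [h3, Finset.sum_ite_eq', Finset.mem_univ, if_true]
    rw [← Finset.sum_mul]
    push_cast
    rw [ofReal_frobSq, trace_mul_comm, mul_comm]
    rfl
  exact_mod_cast hc

end Network

/-! ### The second moment of the derivative over Haar random blocks -/

section Gradient

variable {n : ℕ}

/-- The perceptrons that belong to the blocks `b`, with the operator `G` inserted between the two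
parts of the `j`-th one. -/
def insertedPerceptron (j : Fin n) (G : Matrix (PQubits n) (PQubits n) ℂ)
    (b : Option (Fin n) → unitaryGroup (PQubits n) ℂ) (k : Fin n) :
    Matrix (PQubits n) (PQubits n) ℂ :=
  if k = j then (b none : Matrix (PQubits n) (PQubits n) ℂ) * G * (b (some j) : Matrix _ _ ℂ)
  else (b (some k) : Matrix _ _ ℂ)

/-- The network that belongs to the blocks `b`, with the operator `G` inserted between the two
parts of the `j`-th perceptron. -/
def insertedNetwork (j : Fin n) (G : Matrix (PQubits n) (PQubits n) ℂ)
    (b : Option (Fin n) → unitaryGroup (PQubits n) ℂ) :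
    Matrix (Qubits n × Qubits n) (Qubits n × Qubits n) ℂ :=
  orderedProd (List.finRange n).reverse (insertedPerceptron j G b)

/-- The derivative of the expectation value of `K` in the output state with respect to an angle
with generator `Γ`, as a function of the blocks. -/
def gradient (K : Matrix (Qubits n) (Qubits n) ℂ) (φ : EuclideanSpace ℂ (Qubits n)) (j : Fin n)
    (Γ : Matrix (PQubits n) (PQubits n) ℂ) (b : Option (Fin n) → unitaryGroup (PQubits n) ℂ) : ℂ :=
  -(Complex.I / 2) *
    (trace (onOut K * ((insertedNetwork j Γ b * initialKet φ)
        * (insertedNetwork j 1 b * initialKet φ)ᴴ))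
      - trace (onOut K * ((insertedNetwork j 1 b * initialKet φ)
        * (insertedNetwork j Γ b * initialKet φ)ᴴ)))

theorem continuous_insertedNetwork (j : Fin n) (G : Matrix (PQubits n) (PQubits n) ℂ) :
    Continuous (insertedNetwork j G) := by
  refine continuous_orderedProd _ fun k => ?_
  unfold insertedPerceptron
  split_ifs <;> fun_prop

theorem continuous_gradient (K : Matrix (Qubits n) (Qubits n) ℂ)
    (φ : EuclideanSpace ℂ (Qubits n)) (j : Fin n) (Γ : Matrix (PQubits n) (PQubits n) ℂ) :
    Continuous (gradient K φ j Γ) := by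
  have h := continuous_insertedNetwork j Γ
  have h' := continuous_insertedNetwork j (1 : Matrix (PQubits n) (PQubits n) ℂ)
  unfold gradient
  fun_prop

/-- The network is linear in each single block. -/
theorem exists_insertedNetwork_update (j : Fin n) (G : Matrix (PQubits n) (PQubits n) ℂ)
    (b : Option (Fin n) → unitaryGroup (PQubits n) ℂ) (o : Option (Fin n)) :
    ∃ (k : Fin n) (P Q : Matrix (PQubits n) (PQubits n) ℂ)
      (L R : Matrix (Qubits n × Qubits n) (Qubits n × Qubits n) ℂ),
      ∀ u, insertedNetwork j G (Function.update b o u)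
        = L * onInOut k (P * (u : Matrix (PQubits n) (PQubits n) ℂ) * Q) * R := by
  have key : ∀ (k : Fin n) (P Q : Matrix (PQubits n) (PQubits n) ℂ),
      (∀ u i, insertedPerceptron j G (Function.update b o u) i
        = if i = k then P * (u : Matrix (PQubits n) (PQubits n) ℂ) * Q
          else insertedPerceptron j G b i) →
      ∃ (k : Fin n) (P Q : Matrix (PQubits n) (PQubits n) ℂ)
      (L R : Matrix (Qubits n × Qubits n) (Qubits n × Qubits n) ℂ),
      ∀ u, insertedNetwork j G (Function.update b o u)
        = L * onInOut k (P * (u : Matrix (PQubits n) (PQubits n) ℂ) * Q) * R := by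
    intro k P Q h
    obtain ⟨l₁, l₂, hl, h₁, h₂⟩ := exists_split_reverse_finRange k
    refine ⟨k, P, Q, orderedProd l₁ (insertedPerceptron j G b),
      orderedProd l₂ (insertedPerceptron j G b), fun u => ?_⟩
    rw [insertedNetwork, hl, orderedProd_append_cons, h u k, if_pos rfl]
    congr 1
    · congr 1
      refine orderedProd_congr fun i hi => ?_
      rw [h u i, if_neg (by rintro rfl; exact h₁ hi)]
    · refine orderedProd_congr fun i hi => ?_
      rw [h u i, if_neg (by rintro rfl; exact h₂ hi)]
  cases o with
  | none =>
    refine key j 1 (G * (b (some j) : Matrix _ _ ℂ)) fun u i => ?_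
    by_cases hi : i = j <;> simp [insertedPerceptron, hi, Matrix.mul_assoc]
  | some k =>
    by_cases hk : k = j
    · subst hk
      refine key k ((b none : Matrix _ _ ℂ) * G) 1 fun u i => ?_
      by_cases hi : i = k <;> simp [insertedPerceptron, hi]
    · refine key k 1 1 fun u i => ?_
      by_cases hi : i = k
      · subst hi; simp [insertedPerceptron, hk]
      · by_cases hij : i = j
        · subst hij; simp [insertedPerceptron, Ne.symm hk]
        · simp [insertedPerceptron, hi, hij]

theorem MatHasBidegree.onInOut {m : Type*} [Fintype m] [DecidableEq m] {s t : ℕ} (k : Fin n)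
    {F : unitaryGroup m ℂ → Matrix (PQubits n) (PQubits n) ℂ} (hF : MatHasBidegree s t F) :
    MatHasBidegree s t fun U => onInOut k (F U) := by
  intro a b
  unfold DQNN.onInOut
  simp only [of_apply]
  split_ifs
  · exact hF _ _
  · exact HasBidegree.const s t 0

theorem matHasBidegree_insertedNetwork (j : Fin n) (G : Matrix (PQubits n) (PQubits n) ℂ)
    (b : Option (Fin n) → unitaryGroup (PQubits n) ℂ) (o : Option (Fin n)) :
    MatHasBidegree 1 0 fun u => insertedNetwork j G (Function.update b o u) := by
  obtain ⟨k, P, Q, L, R, h⟩ := exists_insertedNetwork_update j G b o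
  simp only [h]
  exact ((MatHasBidegree.const L).mul
    ((((MatHasBidegree.const P).mul MatHasBidegree.coe).mul
      (MatHasBidegree.const Q)).onInOut k)).mul (MatHasBidegree.const R)

theorem hasBidegree_gradient (K : Matrix (Qubits n) (Qubits n) ℂ)
    (φ : EuclideanSpace ℂ (Qubits n)) (j : Fin n) (Γ : Matrix (PQubits n) (PQubits n) ℂ)
    (b : Option (Fin n) → unitaryGroup (PQubits n) ℂ) (o : Option (Fin n)) :
    HasBidegree 1 1 fun u => gradient K φ j Γ (Function.update b o u) := by
  have h : ∀ G, MatHasBidegree 1 0 fun u =>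
      insertedNetwork j G (Function.update b o u) * initialKet φ := fun G =>
    (matHasBidegree_insertedNetwork j G b o).mul (MatHasBidegree.const _)
  have h2 : ∀ G G', HasBidegree 1 1 fun u => trace (onOut K *
      ((insertedNetwork j G (Function.update b o u) * initialKet φ)
        * (insertedNetwork j G' (Function.update b o u) * initialKet φ)ᴴ)) := fun G G' =>
    ((MatHasBidegree.const (onOut K)).mul ((h G).mul (h G').conjTranspose)).trace
  exact ((h2 Γ 1).sub (h2 1 Γ)).const_mul _

/-- In terms of the whole perceptrons `V` and the part `B` of the `j`-th one, the derivative is a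
linear functional of `B Γ B†`. It is given by the partial trace of a commutator, which is traceless
and has small Frobenius norm when `K` has a small expectation value. -/
theorem exists_gradient_eq_trace {K : Matrix (Qubits n) (Qubits n) ℂ} (hK : K.IsHermitian)
    (φ : EuclideanSpace ℂ (Qubits n)) (hφ : ‖φ‖ = 1) (j : Fin n)
    {Γ : Matrix (PQubits n) (PQubits n) ℂ} (hΓ : Γ.IsHermitian)
    (V : Fin n → unitaryGroup (PQubits n) ℂ) :
    ∃ y : Matrix (PQubits n) (PQubits n) ℂ, trace y = 0 ∧
      frobSq y ≤ frobSq (onOut K * (network V * initialKet φ)) ∧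
      ∀ b : Option (Fin n) → unitaryGroup (PQubits n) ℂ, (∀ k, b (some k) = V k) →
        gradient K φ j Γ (Function.update b (some j) ((b none)⁻¹ * b (some j)))
          = trace (y * conjBy (b none) Γ) := by
  obtain ⟨l₁, l₂, hl, h₁, h₂⟩ := exists_split_reverse_finRange j
  set S := initialKet φ with hS
  set L := orderedProd l₁ fun k => (V k : Matrix (PQubits n) (PQubits n) ℂ) with hL
  set R := orderedProd l₂ fun k => (V k : Matrix (PQubits n) (PQubits n) ℂ) with hR
  set T := onInOut j (V j : Matrix (PQubits n) (PQubits n) ℂ) with hT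
  have hRR : Rᴴ * R = 1 := mem_unitaryGroup_iff'.1 (orderedProd_mem_unitary l₂ V)
  have hTT : Tᴴ * T = 1 := mem_unitaryGroup_iff'.1 (onInOut_mem_unitary j (V j))
  have hN : network V = L * T * R := by
    rw [network_eq_orderedProd, hl, orderedProd_append_cons]
  have hKK : (onOut K)ᴴ = onOut K := by rw [onOut_conjTranspose, hK.eq]
  -- `v` is the state after `V_j`, and `w` the evolved observable applied to it.
  set v := T * (R * S) with hv
  set w := Lᴴ * (onOut K * (network V * S)) with hw
  have hv1 : frobSq v = 1 := by
    rw [hv, frobSq_mul_of_conjTranspose_mul_eq_one hTT,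
      frobSq_mul_of_conjTranspose_mul_eq_one hRR, hS, frobSq_initialKet φ hφ]
  have hw1 : frobSq w = frobSq (onOut K * (network V * S)) := by
    rw [hw, frobSq_mul_of_conjTranspose_mul_eq_one]
    rw [conjTranspose_conjTranspose]
    exact mem_unitaryGroup_iff.1 (orderedProd_mem_unitary l₁ V)
  have hNS : network V * S = L * v := by rw [hN, hv]; simp only [Matrix.mul_assoc]
  have hns : frobSq (-(Complex.I / 2) • traceRest j (v * wᴴ - w * vᴴ)) ≤ frobSq w := by
    have e1 : frobSq (traceRest j (v * wᴴ)) ≤ frobSq w := by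
      simpa [hv1] using frobSq_traceRest_le j v w
    have e2 : frobSq (traceRest j (w * vᴴ)) ≤ frobSq w := by
      simpa [hv1] using frobSq_traceRest_le j w v
    have e3 : frobSq (-(Complex.I / 2) • traceRest j (v * wᴴ - w * vᴴ))
        ≤ (1 / 2) * (frobSq (traceRest j (v * wᴴ)) + frobSq (traceRest j (w * vᴴ))) := by
      rw [traceRest_sub]
      simp only [frobSq, ← Finset.sum_add_distrib, Finset.mul_sum]
      refine Finset.sum_le_sum fun p _ => Finset.sum_le_sum fun q _ => ?_
      simp only [Matrix.smul_apply, Matrix.sub_apply, smul_eq_mul, norm_mul, norm_neg, norm_div, Complex.norm_I]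
      have := norm_sub_le (traceRest j (v * wᴴ) p q) (traceRest j (w * vᴴ) p q)
      have h0 := norm_nonneg (traceRest j (v * wᴴ) p q - traceRest j (w * vᴴ) p q)
      have h4 : ‖(2 : ℂ)‖ = 2 := by simp
      rw [h4]
      nlinarith [sq_nonneg (‖traceRest j (v * wᴴ) p q‖ - ‖traceRest j (w * vᴴ) p q‖)]
    linarith
  refine ⟨-(Complex.I / 2) • traceRest j (v * wᴴ - w * vᴴ), ?_, hns.trans_eq hw1, fun b hb => ?_⟩
  · have e : trace (v * wᴴ) = trace (w * vᴴ) := by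
      rw [hw]
      simp only [conjTranspose_mul, conjTranspose_conjTranspose, hKK]
      rw [trace_mul_comm v, trace_mul_comm _ vᴴ, ← conjTranspose_mul, hNS, conjTranspose_mul]
      simp only [Matrix.mul_assoc]
    rw [trace_smul, trace_traceRest, trace_sub, e, sub_self, smul_zero]
  · set B := b none with hB
    set b' := Function.update b (some j) (B⁻¹ * b (some j)) with hb'
    have hnet : ∀ G, insertedNetwork j G b' = L * onInOut j (conjBy B G) * T * R := by
      intro G
      rw [insertedNetwork, hl, orderedProd_append_cons]
      have e1 : ∀ i, i ≠ j → insertedPerceptron j G b' i = V i := by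
        intro i hi
        simp [insertedPerceptron, hi, hb', hb]
      have e2 : insertedPerceptron j G b' j = conjBy B G * (V j : Matrix _ _ ℂ) := by
        have hinv : ((B⁻¹ : unitaryGroup (PQubits n) ℂ) : Matrix (PQubits n) (PQubits n) ℂ)
            = (B : Matrix (PQubits n) (PQubits n) ℂ)ᴴ := rfl
        simp only [insertedPerceptron, if_true, hb', Function.update_self, hb, conjBy,
          Submonoid.coe_mul, hinv, Matrix.mul_assoc]
        rw [Function.update_of_ne (by simp)]
      rw [e2, onInOut_mul, orderedProd_congr (W' := fun k => (V k : Matrix _ _ ℂ))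
        (fun i hi => e1 i (by rintro rfl; exact h₁ hi)),
        orderedProd_congr (l := l₂) (W' := fun k => (V k : Matrix _ _ ℂ))
        (fun i hi => e1 i (by rintro rfl; exact h₂ hi))]
      simp only [Matrix.mul_assoc, hL, hR, hT]
    have hone : insertedNetwork j 1 b' = network V := by
      rw [hnet, conjBy, Matrix.mul_one, unitary_mul_conjTranspose, onInOut_one, Matrix.mul_one, hN]
    -- The generator, moved past `V_j`.
    set H := onInOut j (conjBy B Γ) with hH
    have hHH : Hᴴ = H := by
      rw [hH, onInOut_conjTranspose]
      simp only [conjBy, conjTranspose_mul, conjTranspose_conjTranspose, hΓ.eq, Matrix.mul_assoc]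
    have hg : insertedNetwork j Γ b' * S = L * (H * v) := by
      rw [hnet, hv]; simp only [Matrix.mul_assoc, hH]
    rw [gradient, hone, ← hS, hg, Matrix.smul_mul, trace_smul, ← trace_mul_onInOut, ← hH,
      Matrix.sub_mul, trace_sub, smul_eq_mul]
    congr 2
    · calc trace (onOut K * (L * (H * v) * (network V * S)ᴴ))
          = trace ((onOut K * L * H) * (v * (network V * S)ᴴ)) := by simp only [Matrix.mul_assoc]
        _ = trace ((v * (network V * S)ᴴ) * (onOut K * L * H)) := trace_mul_comm _ _
        _ = trace (v * wᴴ * H) := by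
          simp only [hw, conjTranspose_mul, conjTranspose_conjTranspose, hKK, Matrix.mul_assoc]
    · calc trace (onOut K * (network V * S * (L * (H * v))ᴴ))
          = trace ((onOut K * (network V * S) * vᴴ * H) * Lᴴ) := by
            simp only [conjTranspose_mul, hHH, Matrix.mul_assoc]
        _ = trace (Lᴴ * (onOut K * (network V * S) * vᴴ * H)) := trace_mul_comm _ _
        _ = trace (w * vᴴ * H) := by simp only [hw, Matrix.mul_assoc]

/-- The second moment of the derivative over Haar random blocks: the average over the part `B` of
the `j`-th perceptron gives a factor `2 / 2 ^ n`, and the average over the whole perceptrons the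
other one. -/
theorem integral_norm_gradient_sq_le {K : Matrix (Qubits n) (Qubits n) ℂ} (hK : K.IsHermitian)
    (φ : EuclideanSpace ℂ (Qubits n)) (hφ : ‖φ‖ = 1) (j : Fin n)
    {Γ : Matrix (PQubits n) (PQubits n) ℂ} (hΓ : Γ.IsHermitian)
    (hΓ2 : (trace (Γ * Γ)).re ≤ 2 ^ (n + 1)) :
    ∫ b : Option (Fin n) → unitaryGroup (PQubits n) ℂ, ‖gradient K φ j Γ b‖ ^ 2
        ∂(Measure.pi fun _ => haarUnitary (PQubits n))
      ≤ 2 / 2 ^ n * ((1 / 2) ^ n * frobSq K) := by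
  have hcont : Continuous fun b : Option (Fin n) → unitaryGroup (PQubits n) ℂ =>
      ‖gradient K φ j Γ b‖ ^ 2 := (continuous_gradient K φ j Γ).norm.pow 2
  have hne : (none : Option (Fin n)) ≠ some j := by simp
  -- The integrand after the change of variables from `A` to `V_j = B A`.
  have hshear : Continuous fun b : Option (Fin n) → unitaryGroup (PQubits n) ℂ =>
      ‖gradient K φ j Γ (Function.update b (some j) ((b none)⁻¹ * b (some j)))‖ ^ 2 :=
    hcont.comp (continuous_id.update (some j)
      ((continuous_apply none).inv.mul (continuous_apply (some j))))
  have hΓf : frobSq Γ ≤ 2 ^ (n + 1) := by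
    have h : (frobSq Γ : ℂ) = trace (Γ * Γ) := by rw [ofReal_frobSq, hΓ.eq]
    rw [← h] at hΓ2
    simpa using hΓ2
  have hinner : ∀ b : Option (Fin n) → unitaryGroup (PQubits n) ℂ,
      ∫ u, ‖gradient K φ j Γ (Function.update (Function.update b none u) (some j)
        ((Function.update b none u none)⁻¹ * Function.update b none u (some j)))‖ ^ 2
        ∂(haarUnitary (PQubits n))
      ≤ 2 / 2 ^ n * frobSq (onOut K * (network (fun k => b (some k)) * initialKet φ)) := by
    intro b
    obtain ⟨y, hy0, hy1, hy⟩ := exists_gradient_eq_trace hK φ hφ j hΓ fun k => b (some k)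
    have h1 : ∀ u, gradient K φ j Γ (Function.update (Function.update b none u) (some j)
        ((Function.update b none u none)⁻¹ * Function.update b none u (some j)))
        = trace (y * conjBy u Γ) := by
      intro u
      rw [hy (Function.update b none u) (fun k => by simp), Function.update_self]
    simp only [h1]
    have h2 := orbitMoment_le Γ y hy0
    have hQ : 0 ≤ orbitMoment Γ y := integral_nonneg fun u => by positivity
    change orbitMoment Γ y ≤ _
    have hcard : (Fintype.card (PQubits n) : ℝ) = 2 * 2 ^ n := by
      simp [Fintype.card_prod, mul_comm]
    rw [hcard] at h2
    rw [pow_succ'] at hΓf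
    have hp : (1 : ℝ) ≤ 2 ^ n := one_le_pow₀ (by norm_num)
    have hy' := frobSq_nonneg y
    have h3 : (2 * 2 ^ n * (2 * 2 ^ n - 1) : ℝ) * orbitMoment Γ y
        ≤ 2 * (2 * 2 ^ n) * frobSq y := by
      refine h2.trans ?_
      gcongr
    have h4 : (2 * 2 ^ n - 1 : ℝ) * orbitMoment Γ y ≤ 2 * frobSq y := by
      refine le_of_mul_le_mul_left ?_ (by positivity : (0 : ℝ) < 2 * 2 ^ n)
      linarith
    have h5 : (2 : ℝ) ^ n * orbitMoment Γ y ≤ 2 * frobSq y :=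
      (mul_le_mul_of_nonneg_right (by linarith) hQ).trans h4
    have h6 : orbitMoment Γ y ≤ 2 / 2 ^ n * frobSq y := by
      rw [div_mul_eq_mul_div, le_div_iff₀ (by positivity)]
      linarith
    exact h6.trans (mul_le_mul_of_nonneg_left hy1 (by positivity))
  rw [integral_pi_haar_shear hne hcont, integral_pi_resample _ none hshear]
  rw [← integral_frobSq_onOut_network φ hφ K, ← integral_const_mul]
  refine integral_mono_of_nonneg (Filter.Eventually.of_forall fun b =>
    integral_nonneg fun u => by positivity) (Integrable.const_mul ?_ _)
    (Filter.Eventually.of_forall hinner)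
  refine integrable_of_continuous ?_
  have := continuous_orderedProd (List.finRange n).reverse
    (X := Option (Fin n) → unitaryGroup (PQubits n) ℂ)
    (W := fun b k => (b (some k) : Matrix (PQubits n) (PQubits n) ℂ))
    (fun k => by fun_prop)
  simp only [network_eq_orderedProd, frobSq]
  refine continuous_finsetSum _ fun x _ => continuous_finsetSum _ fun y _ =>
    (Continuous.matrix_elem (by fun_prop) x y).norm.pow 2

end Gradient

/-! ### Derivatives with respect to an angle -/

section Derivative

/-- The matrix-valued function `F` of a real variable has the entrywise derivative `F'` at `t`. -/
def HasMatDerivAt {ι κ : Type*} (F : ℝ → Matrix ι κ ℂ) (F' : Matrix ι κ ℂ) (t : ℝ) : Prop :=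
  ∀ a b, HasDerivAt (fun s => F s a b) (F' a b) t

namespace HasMatDerivAt

variable {ι κ τ : Type*} {F : ℝ → Matrix ι κ ℂ} {F' : Matrix ι κ ℂ} {t : ℝ}

protected theorem mul [Fintype κ] {G : ℝ → Matrix κ τ ℂ} {G' : Matrix κ τ ℂ}
    (hF : HasMatDerivAt F F' t) (hG : HasMatDerivAt G G' t) :
    HasMatDerivAt (fun s => F s * G s) (F' * G t + F t * G') t := by
  intro a b
  simp only [mul_apply, Matrix.add_apply, ← Finset.sum_add_distrib]
  exact HasDerivAt.fun_sum fun k _ => (hF a k).mul (hG k b)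

protected theorem const_mul [Fintype ι] (M : Matrix τ ι ℂ) (hF : HasMatDerivAt F F' t) :
    HasMatDerivAt (fun s => M * F s) (M * F') t := by
  intro a b
  simp only [mul_apply]
  exact HasDerivAt.fun_sum fun k _ => (hF k b).const_mul (M a k)

protected theorem mul_const [Fintype κ] (hF : HasMatDerivAt F F' t) (M : Matrix κ τ ℂ) :
    HasMatDerivAt (fun s => F s * M) (F' * M) t := by
  intro a b
  simp only [mul_apply]
  exact HasDerivAt.fun_sum fun k _ => (hF a k).mul_const (M k b)

protected theorem conjTranspose (hF : HasMatDerivAt F F' t) :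
    HasMatDerivAt (fun s => (F s)ᴴ) F'ᴴ t :=
  fun a b => (hF b a).star

protected theorem trace [Fintype ι] {F : ℝ → Matrix ι ι ℂ} {F' : Matrix ι ι ℂ}
    (hF : HasMatDerivAt F F' t) : HasDerivAt (fun s => trace (F s)) (trace F') t :=
  HasDerivAt.fun_sum fun a _ => hF a a

protected theorem onInOut {n : ℕ} (j : Fin n) {F : ℝ → Matrix (PQubits n) (PQubits n) ℂ}
    {F' : Matrix (PQubits n) (PQubits n) ℂ} (hF : HasMatDerivAt F F' t) :
    HasMatDerivAt (fun s => onInOut j (F s)) (onInOut j F') t := by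
  intro a b
  unfold DQNN.onInOut
  simp only [of_apply]
  split_ifs
  · exact hF _ _
  · exact hasDerivAt_const _ _

end HasMatDerivAt

attribute [local instance] Matrix.linftyOpNormedRing Matrix.linftyOpNormedAlgebra in
theorem hasMatDerivAt_rot {m : Type*} [Fintype m] [DecidableEq m] (Γ : Matrix m m ℂ) (t : ℝ) :
    HasMatDerivAt (rot Γ) (-(Complex.I / 2) • (Γ * rot Γ t)) t := by
  intro a b
  have h := hasDerivAt_exp_smul_const' (𝕂 := ℝ) (-(Complex.I / 2) • Γ) t
  have h2 := ((Matrix.entryLinearMap ℝ ℂ a b).toContinuousLinearMap.hasFDerivAt).comp_hasDerivAt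
    t h
  have e : ∀ s : ℝ, rot Γ s = NormedSpace.exp (s • (-(Complex.I / 2) • Γ)) := by
    intro s
    rw [rot, mul_comm, mul_smul, Complex.coe_smul]
  have e2 : (fun s => rot Γ s a b) = (fun s : ℝ =>
      NormedSpace.exp (s • (-(Complex.I / 2) • Γ)) a b) := by ext s; rw [e]
  rw [e2, e, ← Matrix.smul_mul]
  exact h2

end Derivative

section AngleDerivative

variable {n : ℕ}

/-- The factors of a perceptron that come after the one with index `ν`. -/
def Circuit.tail (c : Circuit n) (ν : Fin c.depth) (θ : Fin c.depth → ℝ) :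
    unitaryGroup (PQubits n) ℂ :=
  ((c.gates θ).drop (ν + 1)).prod

theorem Circuit.length_gates (c : Circuit n) (θ : Fin c.depth → ℝ) :
    (c.gates θ).length = c.depth := by simp [Circuit.gates]

theorem Circuit.gates_update (c : Circuit n) (ν : Fin c.depth) (θ : Fin c.depth → ℝ) (t : ℝ) :
    c.gates (Function.update θ ν t) = (c.gates θ).set ν (c.gate ν t) := by
  refine List.ext_getElem (by simp [Circuit.gates]) fun i h₁ h₂ => ?_
  rw [List.getElem_set]
  have hi : i < c.depth := by simpa [Circuit.gates] using h₁
  split_ifs with h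
  · subst h; simp [Circuit.gates]
  · have : (⟨i, hi⟩ : Fin c.depth) ≠ ν := fun h' => h (by rw [← h'])
    simp [Circuit.gates, Function.update_of_ne this]

theorem Circuit.partB_update (c : Circuit n) (ν : Fin c.depth) (θ : Fin c.depth → ℝ) (t : ℝ) :
    c.partB ν (Function.update θ ν t) = c.partB ν θ := by
  rw [Circuit.partB, Circuit.gates_update, List.take_set_of_le le_rfl, Circuit.partB]

theorem Circuit.partA_update (c : Circuit n) (ν : Fin c.depth) (θ : Fin c.depth → ℝ) (t : ℝ) :
    c.partA ν (Function.update θ ν t) = c.gate ν t * c.tail ν θ := by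
  have hν : (ν : ℕ) < (c.gates (Function.update θ ν t)).length := by
    rw [Circuit.length_gates]; exact ν.2
  rw [Circuit.partA, List.drop_eq_getElem_cons hν, List.prod_cons, Circuit.tail]
  simp only [Circuit.gates_update, List.getElem_set_self]
  rw [List.drop_set_of_lt (Nat.lt_succ_self _)]

theorem Circuit.perceptron_eq (c : Circuit n) (ν : Fin c.depth) (θ : Fin c.depth → ℝ) :
    c.perceptron θ = c.partB ν θ * c.partA ν θ := by
  rw [Circuit.perceptron, Circuit.partB, Circuit.partA, List.prod_take_mul_prod_drop]

variable {c : Fin n → Circuit n}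

theorem insertedNetwork_one_blocks (j : Fin n) (ν : Fin (c j).depth) (θ : Angles c) :
    insertedNetwork j 1 (fun o => blocks c j ν o θ)
      = network fun k => (c k).perceptron (θ k) := by
  rw [network_eq_orderedProd, insertedNetwork]
  refine orderedProd_congr fun k _ => ?_
  by_cases hk : k = j
  · subst hk
    simp [insertedPerceptron, blocks, (c k).perceptron_eq ν]
  · simp [insertedPerceptron, blocks, hk]

/-- The angle enters through the first factor of `A` only. -/
theorem hasMatDerivAt_network (j : Fin n) (ν : Fin (c j).depth) (θ : Angles c) (t : ℝ) :
    HasMatDerivAt (fun s => network fun k => (c k).perceptron (setAngle θ j ν s k))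
      (-(Complex.I / 2) •
        insertedNetwork j ((c j).gen ν) fun o => blocks c j ν o (setAngle θ j ν t)) t := by
  obtain ⟨l₁, l₂, hl, h₁, h₂⟩ := exists_split_reverse_finRange j
  set W : Fin n → Matrix (PQubits n) (PQubits n) ℂ :=
    fun k => ((c k).perceptron (θ k) : Matrix (PQubits n) (PQubits n) ℂ) with hW
  set B : Matrix (PQubits n) (PQubits n) ℂ :=
    ((c j).partB ν (θ j) : Matrix (PQubits n) (PQubits n) ℂ) with hB
  set D : Matrix (PQubits n) (PQubits n) ℂ :=
    (c j).fixed ν * ((c j).tail ν (θ j) : Matrix (PQubits n) (PQubits n) ℂ) with hD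
  set Γ := (c j).gen ν with hΓ
  have hins : ∀ (G : Matrix (PQubits n) (PQubits n) ℂ) (s : ℝ),
      insertedNetwork j G (fun o => blocks c j ν o (setAngle θ j ν s))
        = orderedProd l₁ W * onInOut j (B * (G * rot Γ s) * D) * orderedProd l₂ W := by
    intro G s
    have e1 : ∀ k, k ≠ j → insertedPerceptron j G
        (fun o => blocks c j ν o (setAngle θ j ν s)) k = W k := by
      intro k hk
      simp [insertedPerceptron, blocks, setAngle, hk, hW]
    have e2 : insertedPerceptron j G (fun o => blocks c j ν o (setAngle θ j ν s)) j
        = B * (G * rot Γ s) * D := by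
      simp [insertedPerceptron, blocks, setAngle, Circuit.partB_update, Circuit.partA_update,
        Circuit.gate, hB, hD, hΓ, Matrix.mul_assoc]
    rw [insertedNetwork, hl, orderedProd_append_cons, e2,
      orderedProd_congr fun i hi => e1 i (by rintro rfl; exact h₁ hi),
      orderedProd_congr (l := l₂) fun i hi => e1 i (by rintro rfl; exact h₂ hi)]
  have hfun : (fun s => network fun k => (c k).perceptron (setAngle θ j ν s k))
      = fun s => orderedProd l₁ W * onInOut j (B * rot Γ s * D) * orderedProd l₂ W := by
    ext1 s
    rw [← insertedNetwork_one_blocks j ν, hins, Matrix.one_mul]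
  rw [hfun, hins, ← Matrix.smul_mul, ← Matrix.mul_smul, ← onInOut_smul, ← Matrix.smul_mul,
    ← Matrix.mul_smul]
  exact ((((hasMatDerivAt_rot Γ t).const_mul B).mul_const D).onInOut j |>.const_mul _).mul_const _

theorem trace_mul_outState (V : Fin n → unitaryGroup (PQubits n) ℂ)
    (φ : EuclideanSpace ℂ (Qubits n)) (K : Matrix (Qubits n) (Qubits n) ℂ) :
    trace (K * outState V (ketbra φ))
      = trace (onOut K * ((network V * initialKet φ) * (network V * initialKet φ)ᴴ)) := by
  rw [outState, trace_mul_traceIn, ← initialKet_mul_conjTranspose]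
  simp only [conjTranspose_mul, Matrix.mul_assoc]

theorem hasDerivAt_trace_outState (K : Matrix (Qubits n) (Qubits n) ℂ)
    (φ : EuclideanSpace ℂ (Qubits n)) (j : Fin n) (ν : Fin (c j).depth) (θ : Angles c) (t : ℝ) :
    HasDerivAt (fun s => trace (K * outState (fun k => (c k).perceptron (setAngle θ j ν s k))
        (ketbra φ)))
      (gradient K φ j ((c j).gen ν) fun o => blocks c j ν o (setAngle θ j ν t)) t := by
  have hN := (hasMatDerivAt_network j ν θ t).mul_const (initialKet φ)
  have h := ((hN.mul hN.conjTranspose).const_mul (onOut K)).trace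
  simp only [trace_mul_outState]
  convert h using 1
  rw [gradient, insertedNetwork_one_blocks]
  simp only [Matrix.smul_mul, Matrix.mul_smul, conjTranspose_smul, Matrix.mul_add, trace_add,
    trace_smul, smul_eq_mul]
  have : star (-(Complex.I / 2)) = Complex.I / 2 := by simp [neg_div]
  rw [this]
  ring

theorem trace_outState_one (V : Fin n → unitaryGroup (PQubits n) ℂ)
    (φ : EuclideanSpace ℂ (Qubits n)) (hφ : ‖φ‖ = 1) :
    trace (outState V (ketbra φ)) = 1 := by
  have h := trace_mul_outState V φ 1
  have hU : (network V)ᴴ * network V = 1 := by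
    rw [network_eq_orderedProd]
    exact mem_unitaryGroup_iff'.1 (orderedProd_mem_unitary _ V)
  rw [Matrix.one_mul, onOut_one, Matrix.one_mul, ← ofReal_frobSq,
    frobSq_mul_of_conjTranspose_mul_eq_one hU, frobSq_initialKet φ hφ] at h
  simpa using h

theorem setAngle_self (j : Fin n) (ν : Fin (c j).depth) (θ : Angles c) :
    setAngle θ j ν (θ j ν) = θ := by
  simp [setAngle]

variable {N : ℕ} {φ : Fin N → EuclideanSpace ℂ (Qubits n)}

/-- The identity in the observable contributes a constant, because output states have trace one. -/
theorem hasDerivAt_angleCost (hφ : ∀ x, ‖φ x‖ = 1) (K : Fin N → Matrix (Qubits n) (Qubits n) ℂ)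
    (j : Fin n) (ν : Fin (c j).depth) (θ : Angles c) (t : ℝ) :
    HasDerivAt (fun s => angleCost c φ (fun x => 1 - K x) (setAngle θ j ν s))
      ((1 / (N : ℝ)) * ∑ x, -(gradient (K x) (φ x) j ((c j).gen ν)
        fun o => blocks c j ν o (setAngle θ j ν t)).re) t := by
  unfold angleCost cost
  refine HasDerivAt.const_mul _ (HasDerivAt.fun_sum fun x _ => ?_)
  simp only [Matrix.sub_mul, Matrix.one_mul, trace_sub, trace_outState_one _ (φ x) (hφ x),
    Complex.sub_re, Complex.one_re]
  have h := Complex.reCLM.hasFDerivAt.comp_hasDerivAt t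
    (hasDerivAt_trace_outState (K x) (φ x) j ν θ t)
  exact h.const_sub 1

theorem partialCost_eq (hφ : ∀ x, ‖φ x‖ = 1) (K : Fin N → Matrix (Qubits n) (Qubits n) ℂ)
    (j : Fin n) (ν : Fin (c j).depth) (θ : Angles c) :
    partialCost c φ (fun x => 1 - K x) j ν θ
      = (1 / (N : ℝ)) * ∑ x, -(gradient (K x) (φ x) j ((c j).gen ν)
          fun o => blocks c j ν o θ).re := by
  rw [partialCost, (hasDerivAt_angleCost hφ K j ν θ _).deriv, setAngle_self]

end AngleDerivative

/-! ### Random angles -/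

section RandomAngles

variable {n : ℕ} {c : Fin n → Circuit n}

theorem continuous_rot {m : Type*} [Fintype m] [DecidableEq m] (Γ : Matrix m m ℂ) :
    Continuous (rot Γ) :=
  continuous_matrix fun a b =>
    continuous_iff_continuousAt.2 fun t => (hasMatDerivAt_rot Γ t a b).continuousAt

theorem Circuit.continuous_gate (c : Circuit n) (k : Fin c.depth) : Continuous (c.gate k) :=
  (Continuous.subtype_mk (continuous_rot (c.gen k)) _).mul continuous_const

theorem Circuit.gates_eq_map (c : Circuit n) (θ : Fin c.depth → ℝ) :
    c.gates θ = (List.finRange c.depth).map fun k => c.gate k (θ k) := by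
  rw [Circuit.gates, List.ofFn_eq_map]

theorem Circuit.continuous_prod_gates (c : Circuit n) (l : List (Fin c.depth)) :
    Continuous fun θ : Fin c.depth → ℝ => (l.map fun k => c.gate k (θ k)).prod :=
  continuous_list_prod l fun k _ => (c.continuous_gate k).comp (continuous_apply k)

theorem Circuit.continuous_perceptron (c : Circuit n) : Continuous fun θ => c.perceptron θ := by
  simp only [Circuit.perceptron, Circuit.gates_eq_map]
  exact c.continuous_prod_gates _

theorem Circuit.continuous_partB (c : Circuit n) (ν : Fin c.depth) :
    Continuous fun θ => c.partB ν θ := by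
  simp only [Circuit.partB, Circuit.gates_eq_map, ← List.map_take]
  exact c.continuous_prod_gates _

theorem Circuit.continuous_partA (c : Circuit n) (ν : Fin c.depth) :
    Continuous fun θ => c.partA ν θ := by
  simp only [Circuit.partA, Circuit.gates_eq_map, ← List.map_drop]
  exact c.continuous_prod_gates _

theorem continuous_blocks (j : Fin n) (ν : Fin (c j).depth) (o : Option (Fin n)) :
    Continuous (blocks c j ν o) := by
  cases o with
  | none => exact ((c j).continuous_partB ν).comp (continuous_apply j)
  | some i =>
    change Continuous fun θ : Angles c =>
      if i = j then (c j).partA ν (θ j) else (c i).perceptron (θ i)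
    split_ifs
    · exact ((c j).continuous_partA ν).comp (continuous_apply j)
    · exact (c i).continuous_perceptron.comp (continuous_apply i)

/-- The second moment of the derivative over random blocks that are 2-designs, by comparison with
Haar random blocks. -/
theorem integral_norm_gradient_blocks_sq_le {Ω : Type*} [MeasurableSpace Ω] {P : Measure Ω}
    [IsProbabilityMeasure P] {θ : Ω → Angles c} (hθ : Measurable θ) (j : Fin n)
    (ν : Fin (c j).depth) (hind : iIndepFun (fun o ω => blocks c j ν o (θ ω)) P)
    (hdes : ∀ o, IsUnitaryDesign 2 (fun ω => blocks c j ν o (θ ω)) P)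
    {K : Matrix (Qubits n) (Qubits n) ℂ} (hK : K.IsHermitian)
    (φ : EuclideanSpace ℂ (Qubits n)) (hφ : ‖φ‖ = 1) :
    ∫ ω, ‖gradient K φ j ((c j).gen ν) fun o => blocks c j ν o (θ ω)‖ ^ 2 ∂P
      ≤ 2 / 2 ^ n * ((1 / 2) ^ n * frobSq K) := by
  have hg := continuous_gradient K φ j ((c j).gen ν)
  have h := integral_designs_eq_integral_haar (t := 2)
    (X := fun o ω => blocks c j ν o (θ ω))
    (F := fun b => gradient K φ j ((c j).gen ν) b * star (gradient K φ j ((c j).gen ν) b))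
    (fun o => (continuous_blocks j ν o).measurable.comp hθ) hind hdes (hg.mul hg.star)
    (fun b o => (hasBidegree_gradient K φ j _ b o).mul (hasBidegree_gradient K φ j _ b o).star)
  have hs : ∀ z : ℂ, z * star z = ((‖z‖ ^ 2 : ℝ) : ℂ) := fun z => by
    rw [RCLike.star_def, Complex.mul_conj, Complex.normSq_eq_norm_sq]
  simp only [hs] at h
  rw [integral_complex_ofReal, integral_complex_ofReal] at h
  rw [Complex.ofReal_injective h]
  exact integral_norm_gradient_sq_le hK φ hφ j ((c j).gen_hermitian ν) ((c j).gen_trace_sq ν)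

/-- The variance bound for observables `1 - K x` with Hermitian `K x` of bounded Frobenius norm. -/
theorem partialCost_bounds {Ω : Type*} [MeasurableSpace Ω] {P : Measure Ω}
    [IsProbabilityMeasure P] {θ : Ω → Angles c} (hθ : Measurable θ) (j : Fin n)
    (ν : Fin (c j).depth) (hind : iIndepFun (fun o ω => blocks c j ν o (θ ω)) P)
    (hdes : ∀ o, IsUnitaryDesign 2 (fun ω => blocks c j ν o (θ ω)) P)
    {N : ℕ} (hN : 0 < N) {φ : Fin N → EuclideanSpace ℂ (Qubits n)} (hφ : ∀ x, ‖φ x‖ = 1)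
    {K : Fin N → Matrix (Qubits n) (Qubits n) ℂ} (hK : ∀ x, (K x).IsHermitian) {κ : ℝ}
    (hκ : ∀ x, frobSq (K x) ≤ κ) :
    (∀ θ₀ : Angles c, Differentiable ℝ fun t =>
      angleCost c φ (fun x => 1 - K x) (setAngle θ₀ j ν t)) ∧
    MemLp (fun ω => partialCost c φ (fun x => 1 - K x) j ν (θ ω)) 2 P ∧
    variance (fun ω => partialCost c φ (fun x => 1 - K x) j ν (θ ω)) P
      ≤ 2 / 2 ^ n * ((1 / 2) ^ n * κ) := by
  have hmeas : Measurable fun ω o => blocks c j ν o (θ ω) :=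
    measurable_pi_iff.2 fun o => (continuous_blocks j ν o).measurable.comp hθ
  have hg : ∀ x, Continuous (gradient (K x) (φ x) j ((c j).gen ν)) := fun x =>
    continuous_gradient (K x) (φ x) j ((c j).gen ν)
  set G : (Option (Fin n) → unitaryGroup (PQubits n) ℂ) → ℝ := fun b =>
    (1 / (N : ℝ)) * ∑ x, -(gradient (K x) (φ x) j ((c j).gen ν) b).re with hG
  have hGc : Continuous G := continuous_const.mul
    (continuous_finsetSum _ fun x _ => (Complex.continuous_re.comp (hg x)).neg)
  have hX : (fun ω => partialCost c φ (fun x => 1 - K x) j ν (θ ω))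
      = fun ω => G fun o => blocks c j ν o (θ ω) := by
    ext ω; exact partialCost_eq hφ K j ν (θ ω)
  have hXm : AEStronglyMeasurable (fun ω => G fun o => blocks c j ν o (θ ω)) P :=
    (hGc.measurable.comp hmeas).aestronglyMeasurable
  obtain ⟨C, hC⟩ := isCompact_univ.exists_bound_of_continuousOn hGc.continuousOn
  refine ⟨fun θ₀ t => (hasDerivAt_angleCost hφ K j ν θ₀ t).differentiableAt, ?_, ?_⟩
  · rw [hX]
    exact MemLp.of_bound hXm C (Filter.Eventually.of_forall fun ω => hC _ trivial)
  rw [hX]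
  refine (variance_le_expectation_sq hXm).trans ?_
  have hN' : (0 : ℝ) < N := by exact_mod_cast hN
  have hpt : ∀ b, G b ^ 2 ≤ (1 / (N : ℝ)) * ∑ x, ‖gradient (K x) (φ x) j ((c j).gen ν) b‖ ^ 2 := by
    intro b
    have h1 := sq_sum_le_card_mul_sum_sq (s := Finset.univ)
      (f := fun x => -(gradient (K x) (φ x) j ((c j).gen ν) b).re)
    rw [Finset.card_univ, Fintype.card_fin] at h1
    have h2 : ∑ x, (-(gradient (K x) (φ x) j ((c j).gen ν) b).re) ^ 2
        ≤ ∑ x, ‖gradient (K x) (φ x) j ((c j).gen ν) b‖ ^ 2 :=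
      Finset.sum_le_sum fun x _ => by
        rw [neg_sq]
        exact sq_le_sq.2 (by rw [abs_norm]; exact Complex.abs_re_le_norm _)
    rw [hG, mul_pow]
    calc (1 / (N : ℝ)) ^ 2 * (∑ x, -(gradient (K x) (φ x) j ((c j).gen ν) b).re) ^ 2
        ≤ (1 / (N : ℝ)) ^ 2 * (N * ∑ x, ‖gradient (K x) (φ x) j ((c j).gen ν) b‖ ^ 2) := by
          refine mul_le_mul_of_nonneg_left (h1.trans ?_) (by positivity)
          exact mul_le_mul_of_nonneg_left h2 hN'.le
      _ = _ := by field_simp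
  have hint : ∀ x, Integrable (fun ω => ‖gradient (K x) (φ x) j ((c j).gen ν)
      fun o => blocks c j ν o (θ ω)‖ ^ 2) P := by
    intro x
    obtain ⟨C, hC⟩ := isCompact_univ.exists_bound_of_continuousOn
      ((hg x).norm.pow 2).continuousOn
    exact Integrable.of_bound
      (((hg x).norm.pow 2).measurable.comp hmeas).aestronglyMeasurable C
      (Filter.Eventually.of_forall fun ω => hC _ trivial)
  calc ∫ ω, G (fun o => blocks c j ν o (θ ω)) ^ 2 ∂P
      ≤ ∫ ω, (1 / (N : ℝ)) * ∑ x, ‖gradient (K x) (φ x) j ((c j).gen ν)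
          fun o => blocks c j ν o (θ ω)‖ ^ 2 ∂P :=
        integral_mono_of_nonneg (Filter.Eventually.of_forall fun ω => sq_nonneg _)
          ((integrable_finsetSum _ fun x _ => hint x).const_mul _)
          (Filter.Eventually.of_forall fun ω => hpt _)
    _ = (1 / (N : ℝ)) * ∑ x, ∫ ω, ‖gradient (K x) (φ x) j ((c j).gen ν)
          fun o => blocks c j ν o (θ ω)‖ ^ 2 ∂P := by
        rw [integral_const_mul, integral_finsetSum _ fun x _ => hint x]
    _ ≤ (1 / (N : ℝ)) * ∑ _x : Fin N, 2 / 2 ^ n * ((1 / 2) ^ n * κ) := by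
        refine mul_le_mul_of_nonneg_left (Finset.sum_le_sum fun x _ => ?_) (by positivity)
        refine (integral_norm_gradient_blocks_sq_le hθ j ν hind hdes (hK x) (φ x) (hφ x)).trans ?_
        have := hκ x
        gcongr
    _ = 2 / 2 ^ n * ((1 / 2) ^ n * κ) := by
        rw [Finset.sum_const, Finset.card_univ, Fintype.card_fin, nsmul_eq_mul]
        field_simp

end RandomAngles

/-! ### The global and the local observable -/

section Observables

theorem isHermitian_ketbra {ι : Type*} (φ : EuclideanSpace ℂ ι) : (ketbra φ).IsHermitian := by
  ext a b
  simp [ketbra, mul_comm]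

theorem frobSq_ketbra {ι : Type*} [Fintype ι] (φ : EuclideanSpace ℂ ι) (hφ : ‖φ‖ = 1) :
    frobSq (ketbra φ) = 1 := by
  have h : ∑ a, ‖φ a‖ ^ 2 = 1 := by
    rw [← EuclideanSpace.norm_sq_eq, hφ, one_pow]
  simp only [frobSq, ketbra, of_apply, norm_mul, norm_star, mul_pow, ← Finset.mul_sum, h, mul_one]

variable {n : ℕ}

theorem isHermitian_onQubit (j : Fin n) {M : Matrix (Fin 2) (Fin 2) ℂ} (hM : M.IsHermitian) :
    (onQubit j M).IsHermitian := by
  ext a b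
  have hab : (∀ k, k ≠ j → b k = a k) ↔ ∀ k, k ≠ j → a k = b k :=
    forall₂_congr fun k _ => eq_comm
  simp only [conjTranspose_apply, onQubit, of_apply, hab]
  split_ifs
  · exact hM.apply (a j) (b j)
  · simp

theorem frobSq_onQubit_le (j : Fin n) (M : Matrix (Fin 2) (Fin 2) ℂ) :
    frobSq (onQubit j M) ≤ 2 ^ n * frobSq M := by
  have h : ∀ a : Qubits n, ∑ b, ‖onQubit j M a b‖ ^ 2 ≤ frobSq M := by
    intro a
    have h1 : ∑ b, ‖onQubit j M a b‖ ^ 2 = ∑ e, ‖M (a j) e‖ ^ 2 := by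
      rw [← (Equiv.funSplitAt j (Fin 2)).symm.sum_comp, Fintype.sum_prod_type]
      refine Finset.sum_congr rfl fun e _ => ?_
      rw [Finset.sum_eq_single fun k : {k // k ≠ j} => a k]
      · have : ∀ k, k ≠ j → a k = (Equiv.funSplitAt j (Fin 2)).symm (e, fun k => a k) k := by
          intro k hk; simp [hk]
        rw [onQubit, of_apply, if_pos this]
        simp
      · intro r _ hr
        rw [onQubit, of_apply, if_neg]
        · simp
        · intro h
          refine hr (funext fun k => ?_)
          have := h k k.2
          simpa [k.2] using this.symm
      · simp
    rw [h1]
    exact Finset.single_le_sum (f := fun x => ∑ e, ‖M x e‖ ^ 2)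
      (fun x _ => by positivity) (Finset.mem_univ (a j))
  calc frobSq (onQubit j M) ≤ ∑ _a : Qubits n, frobSq M := Finset.sum_le_sum fun a _ => h a
    _ = 2 ^ n * frobSq M := by simp

theorem isHermitian_average_onQubit (ψ : Fin n → EuclideanSpace ℂ (Fin 2)) :
    ((1 / (n : ℂ)) • ∑ k, onQubit k (ketbra (ψ k))).IsHermitian := by
  have h : (∑ k, onQubit k (ketbra (ψ k)))ᴴ = ∑ k, onQubit k (ketbra (ψ k)) := by
    rw [conjTranspose_sum]
    exact Finset.sum_congr rfl fun k _ => isHermitian_onQubit k (isHermitian_ketbra _)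
  rw [IsHermitian, conjTranspose_smul, h]
  simp

/-- Each term has squared Frobenius norm at most `2 ^ n`, and the average is estimated by
convexity. -/
theorem frobSq_average_onQubit_le (hn : 0 < n) (ψ : Fin n → EuclideanSpace ℂ (Fin 2))
    (hψ : ∀ k, ‖ψ k‖ = 1) :
    frobSq ((1 / (n : ℂ)) • ∑ k, onQubit k (ketbra (ψ k))) ≤ 2 ^ n := by
  have hn' : (0 : ℝ) < n := by exact_mod_cast hn
  have h : ∀ a b, ‖((1 / (n : ℂ)) • ∑ k, onQubit k (ketbra (ψ k))) a b‖ ^ 2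
      ≤ (1 / (n : ℝ)) * ∑ k, ‖onQubit k (ketbra (ψ k)) a b‖ ^ 2 := by
    intro a b
    rw [Matrix.smul_apply, Matrix.sum_apply, smul_eq_mul, norm_mul, mul_pow]
    have h1 : ‖∑ k, onQubit k (ketbra (ψ k)) a b‖ ^ 2
        ≤ n * ∑ k, ‖onQubit k (ketbra (ψ k)) a b‖ ^ 2 := by
      refine (pow_le_pow_left₀ (norm_nonneg _) (norm_sum_le _ _) 2).trans ?_
      simpa using sq_sum_le_card_mul_sum_sq (s := Finset.univ)
        (f := fun k => ‖onQubit k (ketbra (ψ k)) a b‖)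
    have h2 : ‖(1 / (n : ℂ))‖ = 1 / n := by simp
    rw [h2]
    refine (mul_le_mul_of_nonneg_left h1 (by positivity)).trans_eq ?_
    field_simp
  calc frobSq ((1 / (n : ℂ)) • ∑ k, onQubit k (ketbra (ψ k)))
      ≤ ∑ a, ∑ b, (1 / (n : ℝ)) * ∑ k, ‖onQubit k (ketbra (ψ k)) a b‖ ^ 2 :=
        Finset.sum_le_sum fun a _ => Finset.sum_le_sum fun b _ => h a b
    _ = (1 / (n : ℝ)) * ∑ k, frobSq (onQubit k (ketbra (ψ k))) := by
        simp only [← Finset.mul_sum, frobSq]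
        congr 1
        rw [Finset.sum_congr rfl fun a _ => Finset.sum_comm, Finset.sum_comm]
    _ ≤ (1 / (n : ℝ)) * ∑ _k : Fin n, (2 : ℝ) ^ n := by
        refine mul_le_mul_of_nonneg_left (Finset.sum_le_sum fun k _ => ?_) (by positivity)
        simpa [frobSq_ketbra _ (hψ k)] using frobSq_onQubit_le k (ketbra (ψ k))
    _ = 2 ^ n := by
        rw [Finset.sum_const, Finset.card_univ, Fintype.card_fin, nsmul_eq_mul]
        field_simp

end Observables

end DQNN

end

theorem theorem1 :
    ∃ g h : ℕ → ℝ,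
      Asymptotics.IsBigO Filter.atTop g (fun n : ℕ => (1 : ℝ) / 2 ^ (2 * n)) ∧
      Asymptotics.IsBigO Filter.atTop h (fun n : ℕ => (1 : ℝ) / 2 ^ n) ∧
      ∀ (n : ℕ) (c : Fin n → DQNN.Circuit n) (j : Fin n) (ν : Fin (c j).depth)
        (Ω : Type*) [MeasurableSpace Ω] (P : Measure Ω) [IsProbabilityMeasure P]
        (θ : Ω → DQNN.Angles c) (_ : Measurable θ)
        (_ : iIndepFun (fun o ω => DQNN.blocks c j ν o (θ ω)) P)
        (_ : ∀ o, DQNN.IsUnitaryDesign 2 (fun ω => DQNN.blocks c j ν o (θ ω)) P)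
        (N : ℕ) (_ : 0 < N)
        (φin : Fin N → EuclideanSpace ℂ (DQNN.Qubits n)) (_ : ∀ x, ‖φin x‖ = 1),
        (∀ φout : Fin N → EuclideanSpace ℂ (DQNN.Qubits n), (∀ x, ‖φout x‖ = 1) →
          (∀ θ₀ : DQNN.Angles c, Differentiable ℝ fun t =>
            DQNN.angleCost c φin (fun x => DQNN.globalObs (φout x)) (DQNN.setAngle θ₀ j ν t)) ∧
          MemLp (fun ω =>
            DQNN.partialCost c φin (fun x => DQNN.globalObs (φout x)) j ν (θ ω)) 2 P ∧
          variance (fun ω =>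
            DQNN.partialCost c φin (fun x => DQNN.globalObs (φout x)) j ν (θ ω)) P ≤ g n) ∧
        (∀ ψ : Fin N → Fin n → EuclideanSpace ℂ (Fin 2), (∀ x k, ‖ψ x k‖ = 1) →
          (∀ θ₀ : DQNN.Angles c, Differentiable ℝ fun t =>
            DQNN.angleCost c φin (fun x => DQNN.localObs (ψ x)) (DQNN.setAngle θ₀ j ν t)) ∧
          MemLp (fun ω =>
            DQNN.partialCost c φin (fun x => DQNN.localObs (ψ x)) j ν (θ ω)) 2 P ∧
          variance (fun ω =>
            DQNN.partialCost c φin (fun x => DQNN.localObs (ψ x)) j ν (θ ω)) P ≤ h n) := by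
  -- Both are `2 / 4 ^ n` times the bound for the squared Frobenius norm of `K`, `1` and `2 ^ n`.
  refine ⟨fun n => 2 / 2 ^ n * ((1 / 2) ^ n * 1), fun n => 2 / 2 ^ n * ((1 / 2) ^ n * 2 ^ n),
    ?_, ?_, ?_⟩
  · refine Asymptotics.IsBigO.of_bound 2 (Filter.Eventually.of_forall fun n => le_of_eq ?_)
    rw [Real.norm_of_nonneg (by positivity), Real.norm_of_nonneg (by positivity), two_mul n,
      pow_add, _root_.one_div_pow]
    field_simp
  · refine Asymptotics.IsBigO.of_bound 2 (Filter.Eventually.of_forall fun n => le_of_eq ?_)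
    rw [Real.norm_of_nonneg (by positivity), Real.norm_of_nonneg (by positivity),
      _root_.one_div_pow]
    field_simp
  · intro n c j ν Ω _ P _ θ hθ hind hdes N hN φin hφin
    refine ⟨fun φout hφout => ?_, fun ψ hψ => ?_⟩
    · exact DQNN.partialCost_bounds hθ j ν hind hdes hN hφin
        (fun x => DQNN.isHermitian_ketbra (φout x))
        (fun x => (DQNN.frobSq_ketbra (φout x) (hφout x)).le)
    · exact DQNN.partialCost_bounds hθ j ν hind hdes hN hφin
        (fun x => DQNN.isHermitian_average_onQubit (ψ x))
        (fun x => DQNN.frobSq_average_onQubit_le j.pos (ψ x) (hψ x))
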